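/- **Setting.** Let $\mathcal M$ be an episodic Markov decision process with measurable state space $\mathcal S$, measurable action space $\mathcal A$, horizon $H\ge 1$, transition kernels $\mathbb P_h(\cdot\mid s,a)$, deterministic non-negative measurable rewards $r_h(s,a)$ ($h=1,\dots,H$) and a fixed initial state $s_1$. For a (measurable, deterministic) policy $\pi=(\pi_h)_{h}$ let $V^\pi_h,Q^\pi_h$ be its value functions (expected sum of the rewards from step $h$ on), and $V^\star_h=\sup_\pi V_h^\pi$, $Q^\star_h=\sup_\pi Q_h^\pi$. A policy $\pi$ is $\eta$-optimal if $V_1^\pi(s_1)\ge V_1^\star(s_1)-\eta$. Let $(\mathcal T_h g)(s,a)=r_h(s,a)+\mathbb E_{s'\sim\mathbb P_h(\cdot\mid s,a)}\max_{a'}g(s',a')$. Let $\mathcal F=\mathcal F_1\times\dots\times\mathcal F_H$ and $\mathcal G=\mathcal G_1\times\dots\times\mathcal G_H$, where $\mathcal F_h,\mathcal G_h$ are sets of measurable functions $\mathcal S\times\mathcal A\to[0,1]$; put $f_{H+1}=0$ for every tuple $f$, and $\mathcal F_{H+1}=\{0\}$. (No further bound on the rewards, such as $\sum_h r_h\le 1$,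 is needed.) For $f\in\mathcal F$ let $\pi_f$ be a greedy policy, $\pi_{f,h}(s)\in\arg\max_a f_h(s,a)$, with a fixed rule for breaking ties; the maxima are assumed to be attained. Assume * (realizability) $Q_h^\star\in\mathcal F_h$ for all $h\in[H]$; * (completeness) $\mathcal T_h\mathcal F_{h+1}\subseteq\mathcal G_h$ for all $h\in[H]$ (for $\mathcal G=\mathcal F$ this is $\mathcal T_h\mathcal F_{h+1}\subseteq\mathcal F_h$). $\mathcal N_{\mathcal F\cup\mathcal G}(\rho)$ is the least number of elements of $\mathcal F\cup\mathcal G$ such that every element of $\mathcal F\cup\mathcal G$ is within $\rho$ of one of them in the metric $\max_h\|f_h-g_h\|_\infty$. For a class $\Phi$ of functions on $\mathcal X$, a probability measure $\nu$ on $\mathcal X$ is $\epsilon$-independent of $\mu_1,\dots,\mu_n$ if some $\phi\in\Phi$ has $\sqrt{\sum_{i}(\mathbb E_{\mu_i}\phi)^2}\le\epsilon<|\mathbb E_\nu\phi|$; $\dim_{\rm DE}(\Phi,\Pi,\epsilon)$ is the supremum of the lengths of sequences in $\Pi$ in which, for some $\epsilon'\ge\epsilon$, each member is $\epsilon'$-independent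 of its predecessors; and $\dim_{\rm BE}(\mathcal F,\Pi,\epsilon)=\max_{h}\dim_{\rm DE}(\{f_h-\mathcal T_hf_{h+1}:f\in\mathcal F\},\Pi_h,\epsilon)$. Let $\mathcal D_{\Delta,h}$ be the set of Dirac measures on $\mathcal S\times\mathcal A$, and $\mathcal D_{\mathcal F,h}$ the set of laws of $(s_h,a_h)$ under the policies $\pi_f$, $f\in\mathcal F$. **Algorithm.** GOLF with parameters $K,\beta$ starts from $\mathcal B^0=\mathcal F$ and, in episodes $k=1,\dots,K$, picks $f^k\in\arg\max_{f\in\mathcal B^{k-1}}f_1(s_1,\pi_f(s_1))$ (assumed to be attained whenever $\mathcal B^{k-1}\neq\emptyset$; an arbitrary element of $\mathcal F$ if $\mathcal B^{k-1}=\emptyset$), follows $\pi^k=\pi_{f^k}$ to collect a trajectory $(s^k_1,a^k_1,\dots,s^k_H,a^k_H,s^k_{H+1})$, and sets $$\mathcal B^k=\Big\{f\in\mathcal F:\ L^k_h(f_h,f_{h+1})\le\inf_{g\in\mathcal G_h}L^k_h(g,f_{h+1})+\beta\ \ \forall h\in[H]\Big\},\qquad L^k_h(\xi,\zeta)=\sum_{i=1}^k\big[\xi(s^i_h,a^i_h)-r_h(s_h^i,a_h^i)-\max_{a'}\zeta(s^i_{h+1},a')\big]^2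 .$$ The dependence of $f^k$ and $\pi_{f^k}$ on the past is measurable. The output $\pi^{\rm out}$ is drawn uniformly from $\pi^1,\dots,\pi^K$, independently of the run. **Statement.** For $\epsilon\in(0,1]$ let $$d=\max\Big\{1,\min_{\Pi\in\{\mathcal D_\Delta,\mathcal D_{\mathcal F}\}}\dim_{\rm BE}(\mathcal F,\Pi,\epsilon/H)\Big\},\quad \rho=\frac{\epsilon^2}{H^2d},\quad L=\frac{H^2d}{\epsilon^2}\log\Big[\mathcal N_{\mathcal F\cup\mathcal G}(\rho)\cdot\frac{Hd}{\epsilon}\Big],$$ and suppose that $d$ and $\mathcal N_{\mathcal F\cup\mathcal G}(\rho)$ are finite. For every $m\ge1$ there are constants $c,C>0$ depending only on $m$ (so absolute constants, for $m=1$ say) such that, for all $\mathcal M,\mathcal F,\mathcal G$ as above, all $\epsilon\in(0,1]$ and all integers $K\ge1$ with $K\ge L$, the output $\pi^{\rm out}$ of GOLF is $C\epsilon$-optimal with probability at least $1/2$ in each of the following two cases: 1. $\beta=c\,\big(\log[\mathcal N_{\mathcal F\cup\mathcal G}(\rho)\cdot HK]+K\rho\big)$; 2. $K\le mL$ and $\beta=c\,\log[\mathcal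 N_{\mathcal F\cup\mathcal G}(\rho)\cdot HK]$. -/

import Mathlib

open MeasureTheory ProbabilityTheory

noncomputable section

namespace Golf

/-- An episodic Markov decision process with measurable state and action spaces, horizon `H`,
transition kernels, deterministic non-negative rewards and a fixed initial state.
Steps are numbered `0, …, H - 1`; the data at indices `h ≥ H` are never used. -/
structure MDP (S A : Type*) [MeasurableSpace S] [MeasurableSpace A] where
  H : ℕ
  P : ℕ → Kernel (S × A) S
  markov : ∀ h, IsMarkovKernel (P h)
  r : ℕ → S × A → ℝ
  measurable_r : ∀ h, Measurable (r h)
  r_nonneg : ∀ h x, 0 ≤ r h x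
  s₁ : S

/-- A tuple `f = (f_h)_h` of functions on state-action pairs. -/
abbrev QTuple (S A : Type*) := ℕ → S × A → ℝ

/-- Measurable deterministic policies. -/
def Policy (S A : Type*) [MeasurableSpace S] [MeasurableSpace A] :=
  {π : ℕ → S → A // ∀ h, Measurable (π h)}

section Values

variable {S A : Type*} [MeasurableSpace S] [MeasurableSpace A]

/-- The law of `s_{h+n}` when the policy `π` is followed from `s_h = s`. -/
def stateLaw (M : MDP S A) (π : ℕ → S → A) (h : ℕ) (s : S) : ℕ → Measure S
  | 0 => Measure.dirac s
  | n + 1 => (stateLaw M π h s n).bind (fun x => M.P (h + n) (x, π (h + n) x))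

/-- `V^π_h(s)`: the expected sum of the rewards at the steps `h, …, H - 1`
when `π` is followed from `s_h = s`. -/
def value (M : MDP S A) (π : ℕ → S → A) (h : ℕ) (s : S) : ℝ :=
  ∑ n ∈ Finset.range (M.H - h),
    ∫ x, M.r (h + n) (x, π (h + n) x) ∂(stateLaw M π h s n)

/-- `Q^π_h(s, a)`: the same, when the action at step `h` is `a` and `π` is followed afterwards. -/
def qValue (M : MDP S A) (π : ℕ → S → A) (h : ℕ) (x : S × A) : ℝ :=
  M.r h x + ∫ s', value M π (h + 1) s' ∂(M.P h x)

/-- The optimal value function. -/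
def vStar (M : MDP S A) (h : ℕ) (s : S) : ℝ :=
  ⨆ π : Policy S A, value M π.1 h s

/-- The optimal action-value function. -/
def qStar (M : MDP S A) (h : ℕ) (x : S × A) : ℝ :=
  ⨆ π : Policy S A, qValue M π.1 h x

/-- The Bellman operator `(T_h g)(s, a) = r_h(s, a) + E_{s' ∼ P_h(s, a)} max_{a'} g(s', a')`. -/
def bellman (M : MDP S A) (h : ℕ) (g : S × A → ℝ) (x : S × A) : ℝ :=
  M.r h x + ∫ s', (⨆ a', g (s', a')) ∂(M.P h x)

/-- The law of `(s_h, a_h)` when `π` is followed from the initial state. -/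
def occupancy (M : MDP S A) (π : ℕ → S → A) (h : ℕ) : Measure (S × A) :=
  (stateLaw M π 0 M.s₁ h).map (fun s => (s, π h s))

end Values

section Classes

variable {S A : Type*}

/-- The component classes `F_h`, followed by `{0}` after the last step. -/
def withTerminal (H : ℕ) (F : ℕ → Set (S × A → ℝ)) (h : ℕ) : Set (S × A → ℝ) :=
  if h < H then F h else {0}

/-- The product class `F_1 × ⋯ × F_H`, each tuple being continued by `0` after the last step. -/
def tuples (H : ℕ) (F : ℕ → Set (S × A → ℝ)) : Set (QTuple S A) :=
  {f | ∀ h, f h ∈ withTerminal H F h}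

/-- The `ρ`-covering number, with centres in the set, for the metric `max_h ‖f_h - g_h‖_∞`. -/
def coverNum (V : Set (QTuple S A)) (ρ : ℝ) : ℕ∞ :=
  ⨅ (C : Set (QTuple S A))
    (_ : C ⊆ V ∧ ∀ f ∈ V, ∃ g ∈ C, ∀ h x, |f h x - g h x| ≤ ρ), C.encard

end Classes

section Eluder

/-- `ν` is `ε`-independent of `μ_0, …, μ_{n-1}` with respect to `Φ`. -/
def EpsIndep {X : Type*} [MeasurableSpace X] (Φ : Set (X → ℝ)) (ε : ℝ)
    (n : ℕ) (μ : ℕ → Measure X) (ν : Measure X) : Prop :=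
  ∃ g ∈ Φ, Real.sqrt (∑ i ∈ Finset.range n, (∫ x, g x ∂(μ i)) ^ 2) ≤ ε ∧ ε < |∫ x, g x ∂ν|

/-- The distributional Eluder dimension: the supremum of the lengths of the sequences in `D` each
of whose members is `ε'`-independent of its predecessors, for one common `ε' ≥ ε`. -/
def dimDE {X : Type*} [MeasurableSpace X] (Φ : Set (X → ℝ)) (D : Set (Measure X)) (ε : ℝ) : ℕ∞ :=
  ⨆ (n : ℕ) (_ : ∃ μ : ℕ → Measure X, (∀ i < n, μ i ∈ D) ∧
    ∃ ε' ≥ ε, ∀ i < n, EpsIndep Φ ε' i μ (μ i)), (n : ℕ∞)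

variable {S A : Type*} [MeasurableSpace S] [MeasurableSpace A]

/-- The Bellman residuals `f_h - T_h f_{h+1}`, `f ∈ F`. -/
def residuals (M : MDP S A) (F : ℕ → Set (S × A → ℝ)) (h : ℕ) : Set (S × A → ℝ) :=
  {φ | ∃ f ∈ tuples M.H F, φ = fun x => f h x - bellman M h (f (h + 1)) x}

/-- The Bellman Eluder dimension with respect to the families `D_h` of measures. -/
def dimBE (M : MDP S A) (F : ℕ → Set (S × A → ℝ)) (D : ℕ → Set (Measure (S × A))) (ε : ℝ) : ℕ∞ :=
  ⨆ (h : ℕ) (_ : h < M.H), dimDE (residuals M F h) (D h) ε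

/-- The laws of `(s_h, a_h)` under the greedy policies `π_f`, `f ∈ F`. -/
def greedyFamily (M : MDP S A) (F : ℕ → Set (S × A → ℝ)) (greedy : QTuple S A → ℕ → S → A)
    (h : ℕ) : Set (Measure (S × A)) :=
  {μ | ∃ f ∈ tuples M.H F, μ = occupancy M (greedy f) h}

/-- The Dirac measures at state-action pairs. -/
def diracFamily (S A : Type*) [MeasurableSpace S] [MeasurableSpace A] (_h : ℕ) :
    Set (Measure (S × A)) :=
  {μ | ∃ x : S × A, μ = Measure.dirac x}

end Eluder

section Assumptions

variable {S A : Type*} [MeasurableSpace S] [MeasurableSpace A]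

/-- The component classes consist of measurable functions with values in `[0, 1]`. -/
def IsFunctionClass (H : ℕ) (F : ℕ → Set (S × A → ℝ)) : Prop :=
  ∀ h < H, ∀ f ∈ F h, Measurable f ∧ ∀ x, f x ∈ Set.Icc (0 : ℝ) 1

/-- `f ↦ π_f` is a rule that assigns a greedy policy to each `f ∈ F`:
`π_{f,h}(s)` maximizes `f_h(s, ·)`, ties being broken in an arbitrary fixed way. -/
def IsGreedyRule (H : ℕ) (F : ℕ → Set (S × A → ℝ)) (greedy : QTuple S A → ℕ → S → A) : Prop :=
  ∀ f ∈ tuples H F, (∀ h, Measurable (greedy f h)) ∧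
    ∀ h < H, ∀ s a, f h (s, a) ≤ f h (s, greedy f h s)

/-- Realizability: `Q*_h ∈ F_h`. -/
def Realizable (M : MDP S A) (F : ℕ → Set (S × A → ℝ)) : Prop :=
  ∀ h < M.H, qStar M h ∈ F h

/-- Generalized completeness: `T_h F_{h+1} ⊆ G_h`. For `G = F` this is completeness. -/
def Complete (M : MDP S A) (F G : ℕ → Set (S × A → ℝ)) : Prop :=
  ∀ h < M.H, ∀ g ∈ withTerminal M.H F (h + 1), bellman M h g ∈ G h

end Assumptions

section Algorithm

variable {S A Ω : Type*} [MeasurableSpace S] [MeasurableSpace A]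

/-- The squared loss `L_{D_h}(ξ, ζ)` on the data of step `h` in the first `k` episodes, where `s i h`
and `a i h` are the state and the action at step `h` of episode `i`. -/
def loss (M : MDP S A) (s : ℕ → ℕ → S) (a : ℕ → ℕ → A) (k h : ℕ) (ξ ζ : S × A → ℝ) : ℝ :=
  ∑ i ∈ Finset.range k,
    (ξ (s i h, a i h) - M.r h (s i h, a i h) - ⨆ a', ζ (s i (h + 1), a')) ^ 2

/-- The confidence set after `k` episodes. For `k = 0` and `β ≥ 0` it is the whole class. -/
def confSet (M : MDP S A) (F G : ℕ → Set (S × A → ℝ)) (β : ℝ)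
    (s : ℕ → ℕ → S) (a : ℕ → ℕ → A) (k : ℕ) : Set (QTuple S A) :=
  {f | f ∈ tuples M.H F ∧ ∀ h < M.H,
    loss M s a k h (f h) (f (h + 1)) ≤ (⨅ g : G h, loss M s a k h g (f (h + 1))) + β}

/-- The action `a_h^k = π_{f^k,h}(s_h^k)`. -/
def action (greedy : QTuple S A → ℕ → S → A) (s : ℕ → ℕ → Ω → S) (f : ℕ → Ω → QTuple S A)
    (ω : Ω) (k h : ℕ) : A :=
  greedy (f k ω) h (s k h ω)

/-- A run of GOLF for `K` episodes with parameter `β` on the probability space `(Ω, Pr)`. Episodes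
are numbered from `0`, `s k h` is the state at step `h` of episode `k` (`s k H` being the last one),
and `f k` is the function chosen for episode `k`. The `σ`-algebra `𝓖 k h` is the information
available when the action of step `h` of episode `k` is taken (at least the data collected up to
then). -/
structure IsRun [MeasurableSpace Ω] (Pr : Measure Ω) (M : MDP S A) (F G : ℕ → Set (S × A → ℝ))
    (greedy : QTuple S A → ℕ → S → A) (K : ℕ) (β : ℝ) (𝓖 : ℕ → ℕ → MeasurableSpace Ω)
    (s : ℕ → ℕ → Ω → S) (f : ℕ → Ω → QTuple S A) : Prop where
  le : ∀ k h, 𝓖 k h ≤ ‹MeasurableSpace Ω›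
  mono_step : ∀ k < K, ∀ h < M.H, 𝓖 k h ≤ 𝓖 k (h + 1)
  mono_episode : ∀ k < K, 𝓖 k M.H ≤ 𝓖 (k + 1) 0
  /-- The states are observed. -/
  measurable_state : ∀ k < K, ∀ h ≤ M.H, Measurable[𝓖 k h] (s k h)
  /-- The function of episode `k` and its greedy policy are chosen before the episode. -/
  measurable_fun : ∀ k < K, ∀ h < M.H,
    @Measurable _ _ (@Prod.instMeasurableSpace _ _ (𝓖 k 0) inferInstance) _
      (fun p : Ω × (S × A) => f k p.1 h p.2)
  measurable_policy : ∀ k < K, ∀ h < M.H,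
    @Measurable _ _ (@Prod.instMeasurableSpace _ _ (𝓖 k 0) inferInstance) _
      (fun p : Ω × S => greedy (f k p.1) h p.2)
  /-- Each episode starts at the initial state. -/
  init : ∀ k < K, ∀ ω, s k 0 ω = M.s₁
  /-- Given the past, the next state has the law `P_h(· | s_h, a_h)`. -/
  transition : ∀ k < K, ∀ h < M.H, ∀ E : Set Ω, MeasurableSet[𝓖 k h] E →
    ∀ B : Set S, MeasurableSet B →
      Pr (E ∩ s k (h + 1) ⁻¹' B) = ∫⁻ ω in E, M.P h (s k h ω, action greedy s f ω k h) B ∂Pr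
  /-- The chosen function belongs to the class. -/
  mem : ∀ k < K, ∀ ω, f k ω ∈ tuples M.H F
  /-- Optimistic planning: `f^k` maximizes `f_1(s_1, π_f(s_1))` over the current confidence set.
  (Should that set be empty, any element of the class may be chosen.) -/
  optimistic : ∀ k < K, ∀ ω,
    (confSet M F G β (fun i h => s i h ω) (action greedy s f ω) k).Nonempty →
      f k ω ∈ confSet M F G β (fun i h => s i h ω) (action greedy s f ω) k ∧
      ∀ f' ∈ confSet M F G β (fun i h => s i h ω) (action greedy s f ω) k,
        f' 0 (M.s₁, greedy f' 0 M.s₁) ≤ f k ω 0 (M.s₁, greedy (f k ω) 0 M.s₁)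

/-- The probability that the output policy, drawn uniformly from `π^1, …, π^K` independently of
the run, is `η`-optimal. -/
def probOptimal [MeasurableSpace Ω] (Pr : Measure Ω) (M : MDP S A)
    (greedy : QTuple S A → ℕ → S → A) (K : ℕ) (f : ℕ → Ω → QTuple S A) (η : ℝ) : ENNReal :=
  (Pr.prod (uniformOn (Set.univ : Set (Fin K))))
    {p | vStar M 0 M.s₁ - η ≤ value M (greedy (f p.2 p.1)) 0 M.s₁}

end Algorithm

end Golf

end

/-!
Completeness makes the excess of the squared loss of `f_h` over that of `T_h f_{h+1}` a martingale
perturbation of the sum of squared Bellman errors. An exponential supermartingale for each pair in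
a finite net of `F ∪ G`, together with a union bound, yields an event of probability at least
`1 - 2 / K` on which `Q*` belongs to every confidence set, while the squared Bellman errors of
`f^k`, summed over the previous episodes, are at most a multiple of `β`.

On this event optimism bounds the regret of episode `k` by the sum over `h` of the mean Bellman
errors of `f^k` along its own greedy policy. If more than about `d b / u ^ 2` of these errors
exceeded `u` while each sum of squares over the past is at most `b`, a greedy selection would
extract an independent sequence longer than the Eluder dimension `d`; summing over the levels `u`
gives the bound `K η + d + 2 √(d b K)`. For Dirac measures the same argument runs along the visited
state-action pairs, whose Bellman errors have the same expectations as the means. With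
`η = ε / H` the total expected regret is at most a multiple of `K ε`, and Markov's inequality
applied to a uniformly chosen episode concludes.
-/

noncomputable section

namespace Golf

section Counting

variable {ι : Type*} [LinearOrder ι] {w : ι → ι → ℝ} {η : ℝ}

/-- Independence with respect to weights: `w t k` measures how much `k` depends on `t`, and `I` is
`η`-independent if each member depends by at most `η` on its predecessors in `I`. -/
def IsIndependent (w : ι → ι → ℝ) (η : ℝ) (I : Finset ι) : Prop :=
  ∀ k ∈ I, ∑ t ∈ I with t < k, w t k ≤ η

theorem exists_isIndependent_subset (w : ι → ι → ℝ) (η : ℝ) (T : Finset ι) :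
    ∃ I ⊆ T, IsIndependent w η I ∧ ∀ k ∈ T \ I, η < ∑ t ∈ I with t < k, w t k := by
  induction T using Finset.induction_on_max with
  | empty => exact ⟨∅, by simp [IsIndependent]⟩
  | insert a T ha ih =>
    obtain ⟨I, hIT, hI, hT⟩ := ih
    by_cases hc : ∑ t ∈ I with t < a, w t a ≤ η
    · have insert_pred : ∀ k ∈ T, (insert a I).filter (· < k) = I.filter (· < k) := fun k hk => by
        rw [Finset.filter_insert, if_neg (ha k hk).not_gt]
      refine ⟨insert a I, Finset.insert_subset_insert _ hIT, fun k hk => ?_, fun k hk => ?_⟩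
      · rcases Finset.mem_insert.mp hk with rfl | hk
        · rwa [Finset.filter_insert, if_neg (lt_irrefl _)]
        · rw [insert_pred k (hIT hk)]
          exact hI k hk
      · simp only [Finset.mem_sdiff, Finset.mem_insert, not_or] at hk
        have hkT : k ∈ T := hk.1.resolve_left hk.2.1
        rw [insert_pred k hkT]
        exact hT k (Finset.mem_sdiff.mpr ⟨hkT, hk.2.2⟩)
    · refine ⟨I, hIT.trans (Finset.subset_insert _ _), hI, fun k hk => ?_⟩
      simp only [Finset.mem_sdiff, Finset.mem_insert] at hk
      rcases hk.1 with rfl | hkT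
      · exact not_le.mp hc
      · exact hT k (Finset.mem_sdiff.mpr ⟨hkT, hk.2⟩)

theorem card_le_mul_of_forall_isIndependent_card_le (hw : ∀ t k, 0 ≤ w t k) {d : ℕ} (n : ℕ)
    {T : Finset ι} (hd : ∀ I ⊆ T, IsIndependent w η I → I.card ≤ d)
    (hT : ∀ k ∈ T, ∑ t ∈ T with t < k, w t k < n * η) : T.card ≤ n * d := by
  induction n generalizing T with
  | zero =>
    have hT_empty : T = ∅ := Finset.eq_empty_of_forall_notMem fun k hk =>
      (Finset.sum_nonneg fun t _ => hw t k).not_gt (by simpa using hT k hk)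
    simp [hT_empty]
  | succ n ih =>
    obtain ⟨I, hIT, hI, hdep⟩ := exists_isIndependent_subset w η T
    have hrest : (T \ I).card ≤ n * d := by
      refine ih (fun J hJ => hd J (hJ.trans Finset.sdiff_subset)) fun k hk => ?_
      have htotal := hT k (Finset.mem_sdiff.mp hk).1
      have hsplit : ∑ t ∈ T \ I with t < k, w t k + ∑ t ∈ I with t < k, w t k
          = ∑ t ∈ T with t < k, w t k := by
        simp only [Finset.sum_filter]
        exact Finset.sum_sdiff hIT
      push_cast at htotal
      linarith [hdep k hk]
    calc T.card = (T \ I).card + I.card := (Finset.card_sdiff_add_card_eq_card hIT).symm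
      _ ≤ n * d + d := Nat.add_le_add hrest (hd I hIT hI)
      _ = (n + 1) * d := (Nat.succ_mul n d).symm

end Counting

section LayerCake

variable {ι : Type*} {T : Finset ι} {e : ι → ℝ} {ω : ℝ}

theorem card_le_of_card_filter_lt {T' : Finset ι} {N : ℝ → ℝ} {v : ℝ} (hN : ContinuousAt N v)
    (hv : ω < v) (h : ∀ u ≥ ω, ((T.filter (u < e ·)).card : ℝ) ≤ N u)
    (hT' : ∀ k ∈ T', k ∈ T ∧ v ≤ e k) : (T'.card : ℝ) ≤ N v := by
  have hlim : Filter.Tendsto N (nhdsWithin v (Set.Iio v)) (nhds (N v)) :=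
    hN.tendsto.mono_left nhdsWithin_le_nhds
  refine ge_of_tendsto hlim ?_
  filter_upwards [Ioo_mem_nhdsLT hv] with u hu
  refine le_trans ?_ (h u hu.1.le)
  gcongr
  exact fun k hk => Finset.mem_filter.mpr ⟨(hT' k hk).1, hu.2.trans_le (hT' k hk).2⟩

theorem one_div_sqrt_add_one_le {x : ℝ} (hx : 0 ≤ x) : 1 / √(x + 1) ≤ 2 * (√(x + 1) - √x) := by
  have hpos : 0 < √(x + 1) := Real.sqrt_pos.mpr (by linarith)
  rw [div_le_iff₀ hpos]
  nlinarith [sq_nonneg (√(x + 1) - √x), Real.sq_sqrt hx,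
    Real.sq_sqrt (show 0 ≤ x + 1 by linarith)]

theorem le_two_mul_sqrt_sub_sqrt {x b c n : ℝ} (hx : 0 < x) (hc : 0 ≤ c) (hb : 0 ≤ b) (hcn : c ≤ n)
    (h : n + 1 ≤ c * (b / x ^ 2 + 1)) : x ≤ 2 * √(c * b) * (√(n - c + 1) - √(n - c)) := by
  have hstep : x ≤ √(c * b) * (1 / √(n - c + 1)) := by
    rw [mul_one_div, ← Real.sqrt_div (by positivity)]
    refine Real.le_sqrt_of_sq_le ?_
    rw [le_div_iff₀ (by linarith), ← le_div_iff₀' (by positivity)]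
    calc n - c + 1 ≤ c * (b / x ^ 2 + 1) - c := by linarith
      _ = c * b / x ^ 2 := by ring
  have hsub := one_div_sqrt_add_one_le (sub_nonneg.mpr hcn)
  calc x ≤ √(c * b) * (2 * (√(n - c + 1) - √(n - c))) := hstep.trans (by gcongr)
    _ = 2 * √(c * b) * (√(n - c + 1) - √(n - c)) := by ring

theorem sum_filter_le_of_card_filter_le {b : ℝ} {d : ℕ} (hω : 0 < ω) (hb : 0 ≤ b)
    (hone : ∀ k ∈ T, e k ≤ 1)
    (h : ∀ u ≥ ω, ((T.filter (u < e ·)).card : ℝ) ≤ d * (b / u ^ 2 + 1)) :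
    ∑ k ∈ T with ω < e k, e k ≤ d + 2 * √(d * b * T.card) := by
  classical
  suffices key : ∀ T' ⊆ T.filter (fun k => ω < e k),
      ∑ k ∈ T', e k ≤ d + 2 * √(d * b) * √((T'.card - d : ℕ) : ℝ) by
    refine (key _ subset_rfl).trans ?_
    rw [Real.sqrt_mul (x := d * b) (by positivity), ← mul_assoc]
    gcongr
    exact (Nat.sub_le _ d).trans (Finset.card_filter_le T (ω < e ·))
  intro T'
  -- Adding the elements in decreasing order, the `n`-th one is at most `√(d b / (n - d))`.
  induction T' using Finset.induction_on_min_value e with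
  | empty => intro _; simp
  | insert a T' ha hmin ih =>
    intro hsub
    have hT' := (Finset.subset_insert a T').trans hsub
    have hmem : ∀ k ∈ insert a T', k ∈ T := fun k hk => (Finset.mem_filter.mp (hsub hk)).1
    have hωa : ω < e a := (Finset.mem_filter.mp (hsub (Finset.mem_insert_self a T'))).2
    rcases lt_or_ge T'.card d with hcd | hcd
    · have hsum := Finset.sum_le_card_nsmul (insert a T') e 1 fun k hk => hone k (hmem k hk)
      rw [nsmul_one, Finset.card_insert_of_notMem ha] at hsum
      rw [Finset.card_insert_of_notMem ha, Nat.sub_eq_zero_of_le hcd]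
      simpa using hsum.trans (by exact_mod_cast hcd)
    · have hpos := hω.trans hωa
      have hcount := card_le_of_card_filter_lt (N := fun u => d * (b / u ^ 2 + 1))
        (by fun_prop (disch := positivity)) hωa h fun k hk => ⟨hmem k hk,
          (Finset.mem_insert.mp hk).elim (fun hka => hka ▸ le_rfl) (hmin k)⟩
      have ih := ih hT'
      rw [Finset.card_insert_of_notMem ha, Nat.cast_succ] at hcount
      rw [Nat.cast_sub hcd] at ih
      rw [Finset.sum_insert ha, Finset.card_insert_of_notMem ha, Nat.sub_add_comm hcd,
        Nat.cast_succ, Nat.cast_sub hcd]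
      linarith [le_two_mul_sqrt_sub_sqrt hpos d.cast_nonneg hb (by exact_mod_cast hcd) hcount]

theorem sum_le_of_card_filter_le {b : ℝ} {d : ℕ} (hω : 0 < ω) (hb : 0 ≤ b)
    (hone : ∀ k ∈ T, e k ≤ 1)
    (h : ∀ u ≥ ω, ((T.filter (u < e ·)).card : ℝ) ≤ d * (b / u ^ 2 + 1)) :
    ∑ k ∈ T, e k ≤ T.card * ω + d + 2 * √(d * b * T.card) := by
  have hsmall : ∑ k ∈ T with ¬ ω < e k, e k ≤ T.card * ω :=
    calc ∑ k ∈ T with ¬ ω < e k, e k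
        ≤ (T.filter (¬ ω < e ·)).card * ω := by
          simpa using Finset.sum_le_card_nsmul _ e ω fun k hk =>
            not_lt.mp (Finset.mem_filter.mp hk).2
      _ ≤ T.card * ω := by
          gcongr
          exact Finset.filter_subset _ _
  rw [← Finset.sum_filter_add_sum_filter_not T (ω < e ·)]
  linarith [sum_filter_le_of_card_filter_le hω hb hone h]

end LayerCake

section Eluder

variable {X : Type*} [MeasurableSpace X] {Φ : Set (X → ℝ)} {D : Set (Measure X)} {ω : ℝ} {d : ℕ}

theorem filter_lt_nth_eq_image {I : Finset ℕ} {i : ℕ} (hi : i < I.card) :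
    I.filter (· < Nat.nth (· ∈ I) i) = (Finset.range i).image (Nat.nth (· ∈ I)) := by
  have hfin : (Set.ofPred (· ∈ I)).Finite := I.finite_toSet
  have hcard : hfin.toFinset.card = I.card := congrArg Finset.card I.finite_toSet_toFinset
  rw [← hcard] at hi
  ext t
  simp only [Finset.mem_filter, Finset.mem_image, Finset.mem_range]
  constructor
  · rintro ⟨htI, hlt⟩
    obtain ⟨j, hj, rfl⟩ := Nat.exists_lt_card_finite_nth_eq hfin htI
    exact ⟨j, Nat.lt_of_nth_lt_nth_of_lt_card hfin hlt hj, rfl⟩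
  · rintro ⟨j, hj, rfl⟩
    exact ⟨Nat.nth_mem_of_lt_card hfin (hj.trans hi), Nat.nth_lt_nth_of_lt_card hfin hj hi⟩

theorem card_le_of_dimDE_le (hd : dimDE Φ D ω ≤ d) {u : ℝ} (hu : ω ≤ u) (hu0 : 0 ≤ u)
    {φ : ℕ → X → ℝ} {μ : ℕ → Measure X} {I : Finset ℕ} (hφ : ∀ k ∈ I, φ k ∈ Φ)
    (hμ : ∀ k ∈ I, μ k ∈ D) (hlt : ∀ k ∈ I, u < |∫ x, φ k x ∂μ k|)
    (hI : IsIndependent (fun t k => (∫ x, φ k x ∂μ t) ^ 2) (u ^ 2) I) : I.card ≤ d := by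
  set σ : ℕ → ℕ := Nat.nth (· ∈ I)
  have hfin : (Set.ofPred (· ∈ I)).Finite := I.finite_toSet
  have hcard : hfin.toFinset.card = I.card := congrArg Finset.card I.finite_toSet_toFinset
  have σ_mem : ∀ i < I.card, σ i ∈ I := fun i hi =>
    Nat.nth_mem_of_lt_card hfin (hcard.symm ▸ hi)
  have σ_injOn : ∀ i < I.card, Set.InjOn σ (Finset.range i) := fun i hi =>
    (Nat.nth_injOn hfin).mono fun j hj =>
      (Finset.mem_range.mp hj).trans (hcard.symm ▸ hi)
  suffices (I.card : ℕ∞) ≤ d by exact_mod_cast this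
  refine le_trans (le_iSup₂_of_le I.card ⟨fun i => μ (σ i), fun i hi => hμ _ (σ_mem i hi), u, hu,
    fun i hi => ⟨φ (σ i), hφ _ (σ_mem i hi), ?_, hlt _ (σ_mem i hi)⟩⟩ le_rfl) hd
  have hsum := hI (σ i) (σ_mem i hi)
  rw [filter_lt_nth_eq_image hi, Finset.sum_image (σ_injOn i hi)] at hsum
  exact Real.sqrt_le_iff.mpr ⟨hu0, hsum⟩

theorem card_filter_lt_le_of_dimDE_le {b : ℝ} {K : ℕ} (hb : 0 ≤ b) (hd : dimDE Φ D ω ≤ d)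
    {φ : ℕ → X → ℝ} {μ : ℕ → Measure X} (hφ : ∀ k < K, φ k ∈ Φ) (hμ : ∀ k < K, μ k ∈ D)
    (hsum : ∀ k < K, ∑ t ∈ Finset.range k, (∫ x, φ k x ∂μ t) ^ 2 ≤ b) {u : ℝ} (hu : ω ≤ u)
    (hu0 : 0 < u) :
    (((Finset.range K).filter fun k => u < |∫ x, φ k x ∂μ k|).card : ℝ) ≤ d * (b / u ^ 2 + 1) := by
  set T := (Finset.range K).filter fun k => u < |∫ x, φ k x ∂μ k|
  have hT : ∀ k ∈ T, k < K ∧ u < |∫ x, φ k x ∂μ k| := fun k hk => by simpa [T] using hk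
  have hcard : T.card ≤ (⌊b / u ^ 2⌋₊ + 1) * d := by
    refine card_le_mul_of_forall_isIndependent_card_le (w := fun t k => (∫ x, φ k x ∂μ t) ^ 2)
      (η := u ^ 2) (fun _ _ => sq_nonneg _) _ (fun I hI hind => ?_) fun k hk => ?_
    · exact card_le_of_dimDE_le hd hu hu0.le (fun k hk => hφ k (hT k (hI hk)).1)
        (fun k hk => hμ k (hT k (hI hk)).1) (fun k hk => (hT k (hI hk)).2) hind
    · calc ∑ t ∈ T with t < k, (∫ x, φ k x ∂μ t) ^ 2
          ≤ ∑ t ∈ Finset.range k, (∫ x, φ k x ∂μ t) ^ 2 :=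
            Finset.sum_le_sum_of_subset_of_nonneg (fun t ht => by simp_all)
              fun _ _ _ => sq_nonneg _
        _ ≤ b := hsum k (hT k hk).1
        _ < (⌊b / u ^ 2⌋₊ + 1 : ℕ) * u ^ 2 := by
            rw [← div_lt_iff₀ (by positivity)]
            exact_mod_cast Nat.lt_floor_add_one _
  calc (T.card : ℝ) ≤ ((⌊b / u ^ 2⌋₊ + 1) * d : ℕ) := by exact_mod_cast hcard
    _ = d * (⌊b / u ^ 2⌋₊ + 1) := by push_cast; ring
    _ ≤ d * (b / u ^ 2 + 1) := by gcongr; exact Nat.floor_le (by positivity)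

theorem sum_abs_integral_le_of_dimDE_le {b : ℝ} {K : ℕ} (hω : 0 < ω) (hb : 0 ≤ b)
    (hd : dimDE Φ D ω ≤ d) {φ : ℕ → X → ℝ} {μ : ℕ → Measure X} (hφ : ∀ k < K, φ k ∈ Φ)
    (hμ : ∀ k < K, μ k ∈ D) (hone : ∀ k < K, |∫ x, φ k x ∂μ k| ≤ 1)
    (hsum : ∀ k < K, ∑ t ∈ Finset.range k, (∫ x, φ k x ∂μ t) ^ 2 ≤ b) :
    ∑ k ∈ Finset.range K, |∫ x, φ k x ∂μ k| ≤ K * ω + d + 2 * √(d * b * K) := by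
  simpa only [Finset.card_range] using
    sum_le_of_card_filter_le hω hb (fun k hk => hone k (Finset.mem_range.mp hk)) fun u hu =>
      card_filter_lt_le_of_dimDE_le hb hd hφ hμ hsum hu (hω.trans_le hu)

end Eluder

section Integrals

variable {α β : Type*} [MeasurableSpace α] [MeasurableSpace β] {μ : Measure α}
  [IsProbabilityMeasure μ] {f g : α → ℝ} {a b η : ℝ}

theorem integral_mem_Icc (hf : AEMeasurable f μ) (hab : ∀ x, f x ∈ Set.Icc a b) :
    ∫ x, f x ∂μ ∈ Set.Icc a b :=
  (convex_Icc a b).integral_mem isClosed_Icc (ae_of_all _ hab)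
    (Integrable.of_mem_Icc a b hf (ae_of_all _ hab))

theorem integral_bind_of_mem_Icc (κ : Kernel α β) [IsMarkovKernel κ] {f : β → ℝ}
    (hf : Measurable f) (hab : ∀ y, f y ∈ Set.Icc a b) :
    ∫ y, f y ∂μ.bind κ = ∫ x, ∫ y, f y ∂κ x ∂μ := by
  have hint : Integrable f (μ.bind κ) := Integrable.of_mem_Icc a b hf.aemeasurable (ae_of_all _ hab)
  rw [Measure.comp_eq_comp_const_apply] at hint ⊢
  simpa using Kernel.integral_comp hint

theorem abs_integral_sub_le (hf : Integrable f μ) (hg : Integrable g μ)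
    (h : ∀ x, |f x - g x| ≤ η) : |∫ x, f x ∂μ - ∫ x, g x ∂μ| ≤ η := by
  rw [← integral_sub hf hg]
  simpa using norm_integral_le_of_norm_le_const (f := fun x => f x - g x) (ae_of_all μ h)

theorem sq_integral_le (hf : MemLp f 2 μ) : (∫ x, f x ∂μ) ^ 2 ≤ ∫ x, f x ^ 2 ∂μ := by
  have hvar := variance_nonneg f μ
  rwa [variance_eq_sub hf, sub_nonneg] at hvar

end Integrals

instance {S A : Type*} [MeasurableSpace S] [MeasurableSpace A] (M : MDP S A) (h : ℕ) :
    IsMarkovKernel (M.P h) :=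
  M.markov h

section StateLaw

variable {S A P : Type*} [MeasurableSpace S] [MeasurableSpace A] [MeasurableSpace P] {M : MDP S A}
  {h n : ℕ}

theorem measurable_policy_of_prod {π : P → ℕ → S → A}
    (hπ : ∀ i < M.H, Measurable fun q : P × S => π q.1 i q.2) (p : P) :
    ∀ i < M.H, Measurable (π p i) :=
  fun i hi => (hπ i hi).comp measurable_prodMk_left

theorem stateLaw_succ_eq_comp {π : ℕ → S → A} (hπ : Measurable (π (h + n))) (s : S) :
    stateLaw M π h s (n + 1)
      = (stateLaw M π h s n).bind ((M.P (h + n)).comap _ (measurable_id.prodMk hπ)) :=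
  rfl

theorem isProbabilityMeasure_stateLaw {π : ℕ → S → A} (hπ : ∀ i < M.H, Measurable (π i))
    (hn : h + n ≤ M.H) (s : S) : IsProbabilityMeasure (stateLaw M π h s n) := by
  induction n with
  | zero => exact Measure.dirac.isProbabilityMeasure
  | succ n ih =>
    have := ih (by omega)
    rw [stateLaw_succ_eq_comp (hπ (h + n) (by omega))]
    infer_instance

variable {π : P → ℕ → S → A} {s : P → S}

theorem measurable_stateLaw (hπ : ∀ i < M.H, Measurable fun q : P × S => π q.1 i q.2)
    (hs : Measurable s) (hn : h + n ≤ M.H) :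
    Measurable fun p => stateLaw M (π p) h (s p) n := by
  induction n with
  | zero => exact Measure.measurable_dirac.comp hs
  | succ n ih =>
    let κ : Kernel P S := ⟨_, ih (by omega)⟩
    have : IsMarkovKernel κ := ⟨fun p =>
      isProbabilityMeasure_stateLaw (measurable_policy_of_prod hπ p) (by omega) (s p)⟩
    have hpair : Measurable fun q : P × S => (q.2, π q.1 (h + n) q.2) :=
      measurable_snd.prodMk (hπ (h + n) (by omega))
    have hsnd : ∀ p, stateLaw M (π p) h (s p) (n + 1)
        = (κ ⊗ₖ (M.P (h + n)).comap _ hpair).snd p := by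
      intro p
      ext B hB
      rw [Kernel.snd_apply' _ _ hB, Kernel.compProd_apply (measurable_snd hB)]
      exact Measure.bind_apply hB
        ((M.P (h + n)).measurable.comp (hpair.comp measurable_prodMk_left)).aemeasurable
    simp_rw [hsnd]
    exact Kernel.measurable _

/-- The law of `s_{h+n}` as a kernel, when both the policy and the state at step `h` depend
measurably on a parameter. -/
def stateKernel (hπ : ∀ i < M.H, Measurable fun q : P × S => π q.1 i q.2) (hs : Measurable s)
    (hn : h + n ≤ M.H) : Kernel P S :=
  ⟨fun p => stateLaw M (π p) h (s p) n, measurable_stateLaw hπ hs hn⟩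

instance isMarkovKernel_stateKernel
    (hπ : ∀ i < M.H, Measurable fun q : P × S => π q.1 i q.2) (hs : Measurable s)
    (hn : h + n ≤ M.H) : IsMarkovKernel (stateKernel hπ hs hn) :=
  ⟨fun p => isProbabilityMeasure_stateLaw (measurable_policy_of_prod hπ p) hn (s p)⟩

theorem measurable_integral_stateLaw (hπ : ∀ i < M.H, Measurable fun q : P × S => π q.1 i q.2)
    (hs : Measurable s) (hn : h + n ≤ M.H) {g : P × S → ℝ} (hg : Measurable g) :
    Measurable fun p => ∫ y, g (p, y) ∂stateLaw M (π p) h (s p) n :=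
  (hg.stronglyMeasurable.integral_kernel_prod_right' (κ := stateKernel hπ hs hn)).measurable

theorem stateLaw_succ_eq_bind {π : ℕ → S → A} (hπ : ∀ i < M.H, Measurable (π i))
    (hn : h + (n + 1) ≤ M.H) (s : S) :
    stateLaw M π h s (n + 1) = (M.P h (s, π h s)).bind fun x => stateLaw M π (h + 1) x n := by
  induction n with
  | zero =>
    rw [stateLaw_succ_eq_comp (hπ h (by omega))]
    exact (Measure.dirac_bind (Kernel.measurable _) s).trans Measure.bind_dirac.symm
  | succ n ih =>
    have hlaw : Measurable fun x => stateLaw M π (h + 1) x n :=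
      measurable_stateLaw (π := fun _ => π) (fun i hi => (hπ i hi).comp measurable_snd)
        measurable_id (by omega)
    rw [stateLaw_succ_eq_comp (hπ (h + (n + 1)) (by omega)), ih (by omega),
      Measure.bind_bind hlaw.aemeasurable (Kernel.aemeasurable _)]
    simp only [show h + (n + 1) = h + 1 + n by omega]
    rfl

theorem measurable_lintegral_transition {π : P → S → A}
    (hπ : Measurable fun q : P × S => π q.1 q.2) {g : P × S → ENNReal} (hg : Measurable g) :
    Measurable fun q : P × S => ∫⁻ y, g (q.1, y) ∂M.P h (q.2, π q.1 q.2) :=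
  (hg.comp ((measurable_fst.comp measurable_fst).prodMk
    measurable_snd)).lintegral_kernel_prod_right'
    (κ := (M.P h).comap _ (measurable_snd.prodMk hπ))

theorem lintegral_stateLaw_succ {π : ℕ → S → A} (hπ : Measurable (π h)) (s : S)
    {g : S → ENNReal} (hg : Measurable g) :
    ∫⁻ y, g y ∂stateLaw M π 0 s (h + 1)
      = ∫⁻ x, ∫⁻ y, g y ∂M.P h (x, π h x) ∂stateLaw M π 0 s h := by
  rw [← Nat.zero_add h] at hπ
  rw [stateLaw_succ_eq_comp hπ, Measure.lintegral_bind (Kernel.aemeasurable _) hg.aemeasurable]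
  simp only [Kernel.comap_apply, Nat.zero_add, id]

end StateLaw

section Values

variable {S A P : Type*} [MeasurableSpace S] [MeasurableSpace A] [MeasurableSpace P] {M : MDP S A}
  {π : P → ℕ → S → A} {s : P → S} {h : ℕ}

theorem measurable_value (hπ : ∀ i < M.H, Measurable fun q : P × S => π q.1 i q.2)
    (hs : Measurable s) : Measurable fun p => value M (π p) h (s p) := by
  unfold value
  refine Finset.measurable_fun_sum _ fun n hn => ?_
  have hn : h + n < M.H := by have := Finset.mem_range.mp hn; omega
  exact measurable_integral_stateLaw (g := fun q => M.r (h + n) (q.2, π q.1 (h + n) q.2)) hπ hs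
    hn.le ((M.measurable_r _).comp (measurable_snd.prodMk (hπ _ hn)))

variable {π : ℕ → S → A}

section

variable (hπ : ∀ i < M.H, Measurable (π i)) (hr : ∀ i < M.H, ∀ x, M.r i x ≤ 1)
include hπ hr

theorem value_mem_Icc (s : S) : value M π h s ∈ Set.Icc (0 : ℝ) M.H := by
  have hterm : ∀ n ∈ Finset.range (M.H - h),
      ∫ x, M.r (h + n) (x, π (h + n) x) ∂stateLaw M π h s n ∈ Set.Icc (0 : ℝ) 1 := by
    intro n hn
    have hn : h + n < M.H := by have := Finset.mem_range.mp hn; omega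
    have := isProbabilityMeasure_stateLaw hπ hn.le s
    exact integral_mem_Icc ((M.measurable_r _).comp
      (measurable_id.prodMk (hπ _ hn))).aemeasurable fun x => ⟨M.r_nonneg _ _, hr _ hn _⟩
  refine ⟨Finset.sum_nonneg fun n hn => (hterm n hn).1, ?_⟩
  calc value M π h s ≤ ∑ _n ∈ Finset.range (M.H - h), (1 : ℝ) :=
        Finset.sum_le_sum fun n hn => (hterm n hn).2
    _ = (M.H - h : ℕ) := by simp
    _ ≤ M.H := by exact_mod_cast Nat.sub_le _ _

theorem integrable_value (μ : Measure S) [IsFiniteMeasure μ] : Integrable (value M π h) μ :=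
  Integrable.of_mem_Icc 0 M.H
    (measurable_value (π := fun _ => π) (fun i hi => (hπ i hi).comp measurable_snd)
      measurable_id).aemeasurable
    (ae_of_all _ (value_mem_Icc hπ hr))

theorem value_eq_qValue (hh : h < M.H) (s : S) : value M π h s = qValue M π h (s, π h s) := by
  have hfix : ∀ i < M.H, Measurable fun q : S × S => π i q.2 := fun i hi =>
    (hπ i hi).comp measurable_snd
  have hreward : ∀ i < M.H, Measurable (fun x => M.r i (x, π i x)) ∧
      ∀ x, M.r i (x, π i x) ∈ Set.Icc (0 : ℝ) 1 := fun i hi =>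
    ⟨(M.measurable_r i).comp (measurable_id.prodMk (hπ i hi)), fun _ => ⟨M.r_nonneg _ _, hr i hi _⟩⟩
  have hlt : ∀ n ∈ Finset.range (M.H - (h + 1)), h + 1 + n < M.H := fun n hn => by
    have := Finset.mem_range.mp hn
    omega
  rw [value, show M.H - h = (M.H - (h + 1)) + 1 by omega, Finset.sum_range_succ', add_comm, qValue]
  congr 1
  · exact integral_dirac' _ _ (hreward h hh).1.stronglyMeasurable
  simp only [value]
  rw [integral_finsetSum]
  · refine Finset.sum_congr rfl fun n hn => ?_
    have hle : h + (n + 1) ≤ M.H := by have := hlt n hn; omega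
    rw [show h + (n + 1) = h + 1 + n by omega, stateLaw_succ_eq_bind hπ hle]
    exact integral_bind_of_mem_Icc
      (stateKernel (π := fun _ => π) hfix measurable_id (hlt n hn).le)
      (hreward _ (hlt n hn)).1 (hreward _ (hlt n hn)).2
  · intro n hn
    refine Integrable.of_mem_Icc 0 1 (Measurable.aemeasurable ?_) (ae_of_all _ fun s' => ?_)
    · exact measurable_integral_stateLaw (π := fun _ => π) hfix measurable_id (hlt n hn).le
        ((hreward _ (hlt n hn)).1.comp measurable_snd)
    · have := isProbabilityMeasure_stateLaw hπ (hlt n hn).le s'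
      exact integral_mem_Icc (hreward _ (hlt n hn)).1.aemeasurable (hreward _ (hlt n hn)).2

end

theorem qValue_le_qStar (hπ : ∀ i, Measurable (π i)) (hr : ∀ i < M.H, ∀ x, M.r i x ≤ 1)
    (hh : h < M.H) (x : S × A) : qValue M π h x ≤ qStar M h x := by
  have hbdd : BddAbove (Set.range fun π : Policy S A => qValue M π.1 h x) := by
    refine ⟨1 + M.H, ?_⟩
    rintro _ ⟨π, rfl⟩
    have hπ : ∀ i < M.H, Measurable (π.1 i) := fun i _ => π.2 i
    exact add_le_add (hr h hh x) (integral_mem_Icc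
      (integrable_value hπ hr _).aemeasurable (value_mem_Icc hπ hr)).2
  exact le_ciSup hbdd ⟨π, hπ⟩

end Values

section Classes

variable {S A : Type*} {H h : ℕ} {F : ℕ → Set (S × A → ℝ)} {f : QTuple S A}

theorem mem_of_mem_tuples (hf : f ∈ tuples H F) (hh : h < H) : f h ∈ F h := by
  simpa only [withTerminal, if_pos hh] using hf h

theorem eq_zero_of_mem_tuples (hf : f ∈ tuples H F) (hh : H ≤ h) : f h = 0 := by
  simpa only [withTerminal, if_neg hh.not_gt, Set.mem_singleton_iff] using hf h

theorem abs_ciSup_sub_ciSup_le {ι : Type*} [Nonempty ι] {u v : ι → ℝ} {η : ℝ}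
    (hu : BddAbove (Set.range u)) (hv : BddAbove (Set.range v)) (h : ∀ i, |u i - v i| ≤ η) :
    |(⨆ i, u i) - ⨆ i, v i| ≤ η := by
  refine abs_le.mpr ⟨?_, ?_⟩
  · rw [neg_le_sub_iff_le_add]
    exact ciSup_le fun i => by linarith [(abs_le.mp (h i)).1, le_ciSup hu i]
  · rw [sub_le_iff_le_add]
    exact ciSup_le fun i => by linarith [(abs_le.mp (h i)).2, le_ciSup hv i]

variable [MeasurableSpace S] [MeasurableSpace A]

theorem IsFunctionClass.measurable (hF : IsFunctionClass H F) (hf : f ∈ tuples H F) (h : ℕ) :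
    Measurable (f h) := by
  rcases lt_or_ge h H with hh | hh
  · exact (hF h hh _ (mem_of_mem_tuples hf hh)).1
  · exact eq_zero_of_mem_tuples hf hh ▸ measurable_zero

theorem IsFunctionClass.mem_Icc (hF : IsFunctionClass H F) (hf : f ∈ tuples H F) (h : ℕ)
    (x : S × A) : f h x ∈ Set.Icc (0 : ℝ) 1 := by
  rcases lt_or_ge h H with hh | hh
  · exact (hF h hh _ (mem_of_mem_tuples hf hh)).2 x
  · simp [eq_zero_of_mem_tuples hf hh]

theorem IsFunctionClass.bddAbove (hF : IsFunctionClass H F) (hf : f ∈ tuples H F) (h : ℕ)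
    (s : S) : BddAbove (Set.range fun a => f h (s, a)) :=
  ⟨1, by rintro _ ⟨a, rfl⟩; exact (hF.mem_Icc hf h _).2⟩

end Classes

section Setting

variable {S A : Type*} [MeasurableSpace S] [MeasurableSpace A] {M : MDP S A}
  {F G : ℕ → Set (S × A → ℝ)} {greedy : QTuple S A → ℕ → S → A}
  {f f' q q' : QTuple S A} {h : ℕ} {η : ℝ}

/-- The standing assumptions on the classes: bounded measurable functions, greedy policies,
realizability and completeness. -/
structure Setting (M : MDP S A) (F G : ℕ → Set (S × A → ℝ))
    (greedy : QTuple S A → ℕ → S → A) : Prop where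
  classF : IsFunctionClass M.H F
  classG : IsFunctionClass M.H G
  greedyRule : IsGreedyRule M.H F greedy
  realizable : Realizable M F
  complete : Complete M F G

/-- The tuple `Q*`, continued by `0` after the last step so as to be an element of `tuples`. -/
def qStarTuple (M : MDP S A) : QTuple S A := fun h => if h < M.H then qStar M h else 0

/-- The Bellman error `q_h - T_h ζ_{h+1}` of `q` against the target `ζ`; the Bellman residual of `f`
is the case `q = ζ = f`. -/
def bellmanError (M : MDP S A) (q ζ : QTuple S A) (h : ℕ) (x : S × A) : ℝ :=
  q h x - bellman M h (ζ (h + 1)) x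

theorem qStarTuple_of_lt (hh : h < M.H) : qStarTuple M h = qStar M h := if_pos hh

namespace Setting

variable (hs : Setting M F G greedy)
include hs

theorem measurable_of_mem_union (hq : q ∈ tuples M.H F ∪ tuples M.H G) (h : ℕ) :
    Measurable (q h) :=
  hq.elim (hs.classF.measurable · h) (hs.classG.measurable · h)

theorem mem_Icc_of_mem_union (hq : q ∈ tuples M.H F ∪ tuples M.H G) (h : ℕ) (x : S × A) :
    q h x ∈ Set.Icc (0 : ℝ) 1 :=
  hq.elim (hs.classF.mem_Icc · h x) (hs.classG.mem_Icc · h x)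

theorem measurable_greedy (hf : f ∈ tuples M.H F) (h : ℕ) : Measurable (greedy f h) :=
  (hs.greedyRule f hf).1 h

theorem iSup_eq_greedy (hf : f ∈ tuples M.H F) (h : ℕ) (s : S) :
    ⨆ a, f h (s, a) = f h (s, greedy f h s) := by
  have : Nonempty A := ⟨greedy 0 0 M.s₁⟩
  rcases lt_or_ge h M.H with hh | hh
  · exact le_antisymm (ciSup_le ((hs.greedyRule f hf).2 h hh s))
      (le_ciSup (hs.classF.bddAbove hf h s) (greedy f h s))
  · simp [eq_zero_of_mem_tuples hf hh]

theorem measurable_iSup (hf : f ∈ tuples M.H F) (h : ℕ) : Measurable fun s => ⨆ a, f h (s, a) := by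
  simp_rw [hs.iSup_eq_greedy hf]
  exact (hs.classF.measurable hf h).comp (measurable_id.prodMk (hs.measurable_greedy hf h))

theorem iSup_mem_Icc (hf : f ∈ tuples M.H F) (h : ℕ) (s : S) :
    ⨆ a, f h (s, a) ∈ Set.Icc (0 : ℝ) 1 := by
  rw [hs.iSup_eq_greedy hf]
  exact hs.classF.mem_Icc hf h _

theorem integrable_iSup (hf : f ∈ tuples M.H F) (h : ℕ) (μ : Measure S) [IsFiniteMeasure μ] :
    Integrable (fun s => ⨆ a, f h (s, a)) μ :=
  Integrable.of_mem_Icc 0 1 (hs.measurable_iSup hf h).aemeasurable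
    (ae_of_all _ (hs.iSup_mem_Icc hf h))

theorem abs_iSup_sub_le (hf : f ∈ tuples M.H F) (hf' : f' ∈ tuples M.H F)
    (hη : ∀ x, |f h x - f' h x| ≤ η) (s : S) :
    |(⨆ a, f h (s, a)) - ⨆ a, f' h (s, a)| ≤ η :=
  have : Nonempty A := ⟨greedy 0 0 M.s₁⟩
  abs_ciSup_sub_ciSup_le (hs.classF.bddAbove hf h s) (hs.classF.bddAbove hf' h s) fun _ => hη _

theorem abs_bellman_sub_le (hf : f ∈ tuples M.H F) (hf' : f' ∈ tuples M.H F)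
    (hη : ∀ x, |f (h + 1) x - f' (h + 1) x| ≤ η) (x : S × A) :
    |bellman M h (f (h + 1)) x - bellman M h (f' (h + 1)) x| ≤ η := by
  unfold bellman
  rw [add_sub_add_left_eq_sub]
  exact abs_integral_sub_le (hs.integrable_iSup hf _ _) (hs.integrable_iSup hf' _ _)
    (hs.abs_iSup_sub_le hf hf' hη)

theorem bellman_mem (hf : f ∈ tuples M.H F) (hh : h < M.H) : bellman M h (f (h + 1)) ∈ G h :=
  hs.complete h hh _ (hf (h + 1))

theorem bellman_mem_Icc (hf : f ∈ tuples M.H F) (hh : h < M.H) (x : S × A) :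
    bellman M h (f (h + 1)) x ∈ Set.Icc (0 : ℝ) 1 :=
  (hs.classG h hh _ (hs.bellman_mem hf hh)).2 x

theorem measurable_bellman (hf : f ∈ tuples M.H F) (hh : h < M.H) :
    Measurable (bellman M h (f (h + 1))) :=
  (hs.classG h hh _ (hs.bellman_mem hf hh)).1

theorem measurable_bellmanError (hq : q ∈ tuples M.H F ∪ tuples M.H G) (hf : f ∈ tuples M.H F)
    (hh : h < M.H) : Measurable (bellmanError M q f h) :=
  (hs.measurable_of_mem_union hq h).sub (hs.measurable_bellman hf hh)

theorem bellmanError_mem_Icc (hq : q ∈ tuples M.H F ∪ tuples M.H G) (hf : f ∈ tuples M.H F)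
    (hh : h < M.H) (x : S × A) : bellmanError M q f h x ∈ Set.Icc (-1 : ℝ) 1 := by
  obtain ⟨hq0, hq1⟩ := hs.mem_Icc_of_mem_union hq h x
  obtain ⟨hf0, hf1⟩ := hs.bellman_mem_Icc hf hh x
  exact ⟨by unfold bellmanError; linarith, by unfold bellmanError; linarith⟩

theorem qStarTuple_mem : qStarTuple M ∈ tuples M.H F := by
  intro h
  unfold qStarTuple withTerminal
  split_ifs with hh
  · exact hs.realizable h hh
  · rfl

theorem reward_le_one (hh : h < M.H) (x : S × A) : M.r h x ≤ 1 :=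
  calc M.r h x ≤ bellman M h (qStarTuple M (h + 1)) x :=
        le_add_of_nonneg_right (integral_nonneg fun s => (hs.iSup_mem_Icc hs.qStarTuple_mem _ s).1)
    _ ≤ 1 := (hs.bellman_mem_Icc hs.qStarTuple_mem hh x).2

theorem value_le_iSup_qStar (π : Policy S A) (h : ℕ) (s : S) :
    value M π.1 h s ≤ ⨆ a, qStarTuple M h (s, a) := by
  rcases lt_or_ge h M.H with hh | hh
  · have hr : ∀ i < M.H, ∀ x, M.r i x ≤ 1 := fun _ => hs.reward_le_one
    calc value M π.1 h s = qValue M π.1 h (s, π.1 h s) :=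
          value_eq_qValue (fun i _ => π.2 i) hr hh s
      _ ≤ qStarTuple M h (s, π.1 h s) := by
          rw [qStarTuple_of_lt hh]
          exact qValue_le_qStar π.2 hr hh _
      _ ≤ _ := le_ciSup (hs.classF.bddAbove hs.qStarTuple_mem h s) _
  · rw [value, Nat.sub_eq_zero_of_le hh, Finset.sum_range_zero]
    exact (hs.iSup_mem_Icc hs.qStarTuple_mem h s).1

theorem qStar_le_bellman (hh : h < M.H) (x : S × A) :
    qStarTuple M h x ≤ bellman M h (qStarTuple M (h + 1)) x := by
  have : Nonempty (Policy S A) :=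
    ⟨⟨greedy (qStarTuple M), hs.measurable_greedy hs.qStarTuple_mem⟩⟩
  rw [qStarTuple_of_lt hh]
  exact ciSup_le fun π => add_le_add_right (integral_mono
    (integrable_value (fun i _ => π.2 i) (fun _ => hs.reward_le_one) _)
    (hs.integrable_iSup hs.qStarTuple_mem _ _) fun s => hs.value_le_iSup_qStar π _ s) _

theorem bellman_qStar_le_qValue
    (hvalue : ∀ s, ⨆ a, qStarTuple M (h + 1) (s, a) ≤ value M (greedy (qStarTuple M)) (h + 1) s)
    (x : S × A) :
    bellman M h (qStarTuple M (h + 1)) x ≤ qValue M (greedy (qStarTuple M)) h x :=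
  add_le_add_right (integral_mono (hs.integrable_iSup hs.qStarTuple_mem _ _)
    (integrable_value (fun i _ => hs.measurable_greedy hs.qStarTuple_mem i)
      (fun _ => hs.reward_le_one) _) hvalue) _

theorem iSup_qStar_le_value (h : ℕ) (s : S) :
    ⨆ a, qStarTuple M h (s, a) ≤ value M (greedy (qStarTuple M)) h s := by
  have hr : ∀ i < M.H, ∀ x, M.r i x ≤ 1 := fun _ => hs.reward_le_one
  have hπ : ∀ i < M.H, Measurable (greedy (qStarTuple M) i) := fun i _ =>
    hs.measurable_greedy hs.qStarTuple_mem i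
  rw [hs.iSup_eq_greedy hs.qStarTuple_mem]
  rcases lt_or_ge h M.H with hh | hh
  · rw [value_eq_qValue hπ hr hh]
    exact (hs.qStar_le_bellman hh _).trans
      (hs.bellman_qStar_le_qValue (iSup_qStar_le_value (h + 1)) _)
  · rw [eq_zero_of_mem_tuples hs.qStarTuple_mem hh]
    exact (value_mem_Icc hπ hr s).1
termination_by M.H - h

theorem bellman_qStar (hh : h < M.H) : bellman M h (qStarTuple M (h + 1)) = qStarTuple M h := by
  ext x
  refine le_antisymm ?_ (hs.qStar_le_bellman hh x)
  rw [qStarTuple_of_lt hh]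
  exact (hs.bellman_qStar_le_qValue (hs.iSup_qStar_le_value (h + 1)) x).trans
    (qValue_le_qStar (hs.measurable_greedy hs.qStarTuple_mem) (fun _ => hs.reward_le_one) hh x)

theorem vStar_le_iSup_qStar (h : ℕ) (s : S) : vStar M h s ≤ ⨆ a, qStarTuple M h (s, a) :=
  have : Nonempty (Policy S A) :=
    ⟨⟨greedy (qStarTuple M), hs.measurable_greedy hs.qStarTuple_mem⟩⟩
  ciSup_le fun π => hs.value_le_iSup_qStar π h s

theorem value_le_vStar {π : ℕ → S → A} (hπ : ∀ h, Measurable (π h)) (h : ℕ) (s : S) :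
    value M π h s ≤ vStar M h s := by
  have hbdd : BddAbove (Set.range fun π : Policy S A => value M π.1 h s) := by
    refine ⟨1, ?_⟩
    rintro _ ⟨π, rfl⟩
    exact (hs.value_le_iSup_qStar π h s).trans (hs.iSup_mem_Icc hs.qStarTuple_mem h s).2
  exact le_ciSup hbdd ⟨π, hπ⟩

end Setting

section Occupancy

variable {π : ℕ → S → A}

theorem integral_occupancy (hπ : Measurable (π h)) {g : S × A → ℝ} (hg : Measurable g) :
    ∫ x, g x ∂occupancy M π h = ∫ s, g (s, π h s) ∂stateLaw M π 0 M.s₁ h :=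
  integral_map (measurable_id.prodMk hπ).aemeasurable hg.aestronglyMeasurable

theorem isProbabilityMeasure_occupancy (hπ : ∀ i < M.H, Measurable (π i)) (hh : h < M.H) :
    IsProbabilityMeasure (occupancy M π h) :=
  have := isProbabilityMeasure_stateLaw hπ (by omega : 0 + h ≤ M.H) M.s₁
  Measure.isProbabilityMeasure_map (measurable_id.prodMk (hπ h hh)).aemeasurable

variable (hs : Setting M F G greedy)
include hs

theorem Setting.integral_bellman_occupancy (hπ : ∀ i < M.H, Measurable (π i))
    (hf : f ∈ tuples M.H F) (hh : h < M.H) :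
    ∫ x, bellman M h (f (h + 1)) x ∂occupancy M π h
      = ∫ s, M.r h (s, π h s) ∂stateLaw M π 0 M.s₁ h
        + ∫ s, ⨆ a, f (h + 1) (s, a) ∂stateLaw M π 0 M.s₁ (h + 1) := by
  have := isProbabilityMeasure_stateLaw hπ (by omega : 0 + h ≤ M.H) M.s₁
  have hπ' : Measurable (π (0 + h)) := by simpa using hπ h hh
  let κ : Kernel S S := (M.P (0 + h)).comap _ (measurable_id.prodMk hπ')
  have hnext : Measurable fun s => ∫ s', ⨆ a, f (h + 1) (s', a) ∂κ s :=
    ((hs.measurable_iSup hf (h + 1)).stronglyMeasurable.integral_kernel).measurable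
  rw [integral_occupancy (hπ h hh) (hs.measurable_bellman hf hh), stateLaw_succ_eq_comp hπ',
    integral_bind_of_mem_Icc κ (hs.measurable_iSup hf _) (hs.iSup_mem_Icc hf _), ← integral_add]
  · simp only [κ, Kernel.comap_apply, zero_add, bellman, id]
  · exact Integrable.of_mem_Icc 0 1
      ((M.measurable_r h).comp (measurable_id.prodMk (hπ h hh))).aemeasurable
      (ae_of_all _ fun s => ⟨M.r_nonneg _ _, hs.reward_le_one hh _⟩)
  · exact Integrable.of_mem_Icc 0 1 hnext.aemeasurable (ae_of_all _ fun s =>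
      integral_mem_Icc (hs.measurable_iSup hf _).aemeasurable (hs.iSup_mem_Icc hf _))

theorem Setting.integral_bellmanError_occupancy (hf : f ∈ tuples M.H F) (hh : h < M.H) :
    ∫ x, bellmanError M f f h x ∂occupancy M (greedy f) h
      = ∫ s, (⨆ a, f h (s, a)) ∂stateLaw M (greedy f) 0 M.s₁ h
        - ∫ s, (⨆ a, f (h + 1) (s, a)) ∂stateLaw M (greedy f) 0 M.s₁ (h + 1)
        - ∫ s, M.r h (s, greedy f h s) ∂stateLaw M (greedy f) 0 M.s₁ h := by
  have hπ : ∀ i < M.H, Measurable (greedy f i) := fun i _ => hs.measurable_greedy hf i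
  have := isProbabilityMeasure_occupancy hπ hh
  have hf_int : Integrable (f h) (occupancy M (greedy f) h) := Integrable.of_mem_Icc 0 1
    (hs.classF.measurable hf h).aemeasurable (ae_of_all _ (hs.classF.mem_Icc hf h))
  have hT_int : Integrable (bellman M h (f (h + 1))) (occupancy M (greedy f) h) :=
    Integrable.of_mem_Icc 0 1 (hs.measurable_bellman hf hh).aemeasurable
      (ae_of_all _ (hs.bellman_mem_Icc hf hh))
  simp only [bellmanError]
  rw [integral_sub hf_int hT_int, hs.integral_bellman_occupancy hπ hf hh,
    integral_occupancy (hπ h hh) (hs.classF.measurable hf h)]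
  simp only [hs.iSup_eq_greedy hf h]
  ring

theorem Setting.iSup_sub_value_eq_sum_bellmanError (hf : f ∈ tuples M.H F) :
    (⨆ a, f 0 (M.s₁, a)) - value M (greedy f) 0 M.s₁
      = ∑ h ∈ Finset.range M.H, ∫ x, bellmanError M f f h x ∂occupancy M (greedy f) h := by
  have hinit : ∫ s, (⨆ a, f 0 (s, a)) ∂stateLaw M (greedy f) 0 M.s₁ 0 = ⨆ a, f 0 (M.s₁, a) :=
    integral_dirac' _ _ (hs.measurable_iSup hf 0).stronglyMeasurable
  have hfinal : ∫ s, (⨆ a, f M.H (s, a)) ∂stateLaw M (greedy f) 0 M.s₁ M.H = 0 := by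
    simp [eq_zero_of_mem_tuples hf le_rfl]
  rw [Finset.sum_congr rfl fun h hh =>
      hs.integral_bellmanError_occupancy hf (Finset.mem_range.mp hh),
    Finset.sum_sub_distrib, Finset.sum_range_sub' fun h =>
      ∫ s, (⨆ a, f h (s, a)) ∂stateLaw M (greedy f) 0 M.s₁ h, hinit, hfinal]
  simp [value]

end Occupancy

end Setting

section CondDistrib

variable {Ω Ω' S : Type*} [MeasurableSpace Ω] [MeasurableSpace Ω'] [MeasurableSpace S]
  {Pr : Measure Ω} [IsFiniteMeasure Pr] {T : Ω → Ω'} {X : Ω → S} {κ : Kernel Ω' S}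
  [IsMarkovKernel κ]

theorem hasCondDistrib_of_forall_measure_inter (hT : Measurable T) (hX : Measurable X)
    (h : ∀ E, MeasurableSet E → ∀ B, MeasurableSet B →
      Pr (T ⁻¹' E ∩ X ⁻¹' B) = ∫⁻ ω in T ⁻¹' E, κ (T ω) B ∂Pr) :
    HasCondDistrib X T κ Pr where
  aemeasurable := (hT.prodMk hX).aemeasurable
  map_eq := Measure.ext_prod fun {E B} hE hB => by
    rw [Measure.map_apply (hT.prodMk hX) (hE.prod hB), Measure.compProd_apply_prod hE hB,
      setLIntegral_map hE (κ.measurable_coe hB) hT, ← h E hE B hB]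
    rfl

theorem lintegral_of_hasCondDistrib (h : HasCondDistrib X T κ Pr) (hT : Measurable T)
    {g : Ω' × S → ENNReal} (hg : Measurable g) :
    ∫⁻ ω, g (T ω, X ω) ∂Pr = ∫⁻ ω, ∫⁻ y, g (T ω, y) ∂κ (T ω) ∂Pr := by
  rw [← lintegral_map' (f := g) hg.aemeasurable h.aemeasurable, h.map_eq,
    Measure.lintegral_compProd hg, lintegral_map hg.lintegral_kernel_prod_right' hT]

theorem integral_of_hasCondDistrib (h : HasCondDistrib X T κ Pr) (hT : Measurable T)
    {g : Ω' × S → ℝ} (hg : Measurable g) {a b : ℝ} (hab : ∀ p, g p ∈ Set.Icc a b) :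
    ∫ ω, g (T ω, X ω) ∂Pr = ∫ ω, ∫ y, g (T ω, y) ∂κ (T ω) ∂Pr := by
  rw [← integral_map h.aemeasurable hg.aestronglyMeasurable, h.map_eq,
    Measure.integral_compProd (Integrable.of_mem_Icc a b hg.aemeasurable (ae_of_all _ hab)),
    integral_map hT.aemeasurable
      hg.stronglyMeasurable.integral_kernel_prod_right'.aestronglyMeasurable]

end CondDistrib

section Run

variable {Ω S A : Type*} [MeasurableSpace S] [MeasurableSpace A] [MeasurableSpace Ω]
  {Pr : Measure Ω} {M : MDP S A} {F G : ℕ → Set (S × A → ℝ)}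
  {greedy : QTuple S A → ℕ → S → A} {K : ℕ} {β : ℝ} {𝓖 : ℕ → ℕ → MeasurableSpace Ω}
  {s : ℕ → ℕ → Ω → S} {f : ℕ → Ω → QTuple S A} {k h : ℕ}

/-- The state-action pair at step `h` of episode `k`. -/
def visit (greedy : QTuple S A → ℕ → S → A) (s : ℕ → ℕ → Ω → S) (f : ℕ → Ω → QTuple S A)
    (k h : ℕ) (ω : Ω) : S × A :=
  (s k h ω, action greedy s f ω k h)

namespace IsRun

variable (run : IsRun Pr M F G greedy K β 𝓖 s f)
include run

theorem le_of_step_le (hk : k < K) {i j : ℕ} (hij : i ≤ j) (hj : j ≤ M.H) : 𝓖 k i ≤ 𝓖 k j := by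
  induction j, hij using Nat.le_induction with
  | base => exact le_rfl
  | succ j _ ih => exact (ih (by omega)).trans (run.mono_step k hk j (by omega))

theorem start_le_start_of_le {l : ℕ} (hkl : k ≤ l) (hl : l ≤ K) : 𝓖 k 0 ≤ 𝓖 l 0 := by
  induction l, hkl using Nat.le_induction with
  | base => exact le_rfl
  | succ l _ ih =>
    exact (ih (by omega)).trans
      ((run.le_of_step_le (by omega) (Nat.zero_le _) le_rfl).trans (run.mono_episode l (by omega)))

theorem le_start_of_lt {t j : ℕ} (htk : t < k) (hk : k ≤ K) (hj : j ≤ M.H) : 𝓖 t j ≤ 𝓖 k 0 :=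
  (run.le_of_step_le (by omega) hj le_rfl).trans
    ((run.mono_episode t (by omega)).trans (run.start_le_start_of_le htk hk))

theorem measurable_visit (hk : k < K) (hh : h < M.H) :
    Measurable[𝓖 k h] (visit greedy s f k h) := by
  have hstate := run.measurable_state k hk h hh.le
  have hpair : Measurable[𝓖 k h, (𝓖 k 0).prod inferInstance] fun ω => (ω, s k h ω) :=
    @Measurable.prodMk _ (𝓖 k h) _ _ (𝓖 k 0) _ _ _
      (measurable_id'' (run.le_of_step_le hk (Nat.zero_le _) hh.le)) hstate
  exact hstate.prodMk ((run.measurable_policy k hk h hh).comp hpair)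

variable [IsFiniteMeasure Pr]

theorem hasCondDistrib_next_state (hk : k < K) (hh : h < M.H) :
    HasCondDistrib (m𝓧 := 𝓖 k h) (s k (h + 1)) id
      ((M.P h).comap (visit greedy s f k h) (run.measurable_visit hk hh)) Pr :=
  have : @IsMarkovKernel _ _ (𝓖 k h) _
      ((M.P h).comap (visit greedy s f k h) (run.measurable_visit hk hh)) :=
    Kernel.IsMarkovKernel.comap _ (run.measurable_visit hk hh)
  @hasCondDistrib_of_forall_measure_inter Ω Ω S _ (𝓖 k h) _ Pr _ id _ _ this
    (measurable_id'' (run.le k h))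
    ((run.measurable_state k hk (h + 1) hh).mono (run.le k (h + 1)) le_rfl)
    (run.transition k hk h hh)

theorem lintegral_next_state (hk : k < K) (hh : h < M.H) {g : Ω × S → ENNReal}
    (hg : Measurable[(𝓖 k h).prod inferInstance] g) :
    ∫⁻ ω, g (ω, s k (h + 1) ω) ∂Pr
      = ∫⁻ ω, ∫⁻ y, g (ω, y) ∂M.P h (visit greedy s f k h ω) ∂Pr :=
  have : @IsMarkovKernel _ _ (𝓖 k h) _
      ((M.P h).comap (visit greedy s f k h) (run.measurable_visit hk hh)) :=
    Kernel.IsMarkovKernel.comap _ (run.measurable_visit hk hh)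
  @lintegral_of_hasCondDistrib Ω Ω S _ (𝓖 k h) _ Pr _ id _ _ this
    (run.hasCondDistrib_next_state hk hh) (measurable_id'' (run.le k h)) g hg

theorem lintegral_mul_next_state_le (hk : k < K) (hh : h < M.H) {W : Ω → ENNReal}
    (hW : Measurable[𝓖 k h] W) {g : Ω × S → ENNReal}
    (hg : Measurable[(𝓖 k h).prod inferInstance] g)
    (hle : ∀ ω, ∫⁻ y, g (ω, y) ∂M.P h (visit greedy s f k h ω) ≤ 1) :
    ∫⁻ ω, W ω * g (ω, s k (h + 1) ω) ∂Pr ≤ ∫⁻ ω, W ω ∂Pr := by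
  rw [run.lintegral_next_state (g := fun p => W p.1 * g p) hk hh ((hW.comp measurable_fst).mul hg)]
  refine lintegral_mono fun ω => ?_
  have hslice : Measurable fun y => g (ω, y) := hg.comp measurable_prodMk_left
  exact (lintegral_const_mul _ hslice).trans_le (mul_le_of_le_one_right' (hle ω))

theorem lintegral_state (hk : k < K) (hh : h ≤ M.H) {g : Ω × S → ENNReal}
    (hg : Measurable[(𝓖 k 0).prod inferInstance] g) :
    ∫⁻ ω, g (ω, s k h ω) ∂Pr
      = ∫⁻ ω, ∫⁻ y, g (ω, y) ∂stateLaw M (greedy (f k ω)) 0 M.s₁ h ∂Pr := by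
  induction h generalizing g with
  | zero =>
    refine lintegral_congr fun ω => ?_
    rw [run.init k hk ω]
    exact (lintegral_dirac' M.s₁ (hg.comp measurable_prodMk_left)).symm
  | succ h ih =>
    have hpolicy := run.measurable_policy k hk h hh
    have hle : (𝓖 k 0).prod (inferInstance : MeasurableSpace S) ≤ (𝓖 k h).prod inferInstance :=
      sup_le_sup (MeasurableSpace.comap_mono
        (run.le_of_step_le hk (Nat.zero_le _) (Nat.le_of_succ_le hh))) le_rfl
    have hnext : Measurable[(𝓖 k 0).prod inferInstance] fun p : Ω × S =>
        ∫⁻ y, g (p.1, y) ∂M.P h (p.2, greedy (f k p.1) h p.2) :=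
      @measurable_lintegral_transition S A Ω _ _ (𝓖 k 0) M h (fun ω => greedy (f k ω) h)
        hpolicy g hg
    rw [run.lintegral_next_state hk hh (hg.mono hle le_rfl)]
    refine (ih (Nat.le_of_succ_le hh) hnext).trans (lintegral_congr fun ω => ?_)
    exact (lintegral_stateLaw_succ (hpolicy.comp measurable_prodMk_left) M.s₁
      (hg.comp measurable_prodMk_left)).symm

theorem lintegral_mul_state_le (hk : k < K) (hh : h ≤ M.H) {W : Ω → ENNReal}
    (hW : Measurable[𝓖 k 0] W) {g : Ω × S → ENNReal}
    (hg : Measurable[(𝓖 k 0).prod inferInstance] g)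
    (hle : ∀ ω, ∫⁻ y, g (ω, y) ∂stateLaw M (greedy (f k ω)) 0 M.s₁ h ≤ 1) :
    ∫⁻ ω, W ω * g (ω, s k h ω) ∂Pr ≤ ∫⁻ ω, W ω ∂Pr := by
  rw [run.lintegral_state (g := fun p => W p.1 * g p) hk hh ((hW.comp measurable_fst).mul hg)]
  refine lintegral_mono fun ω => ?_
  have hslice : Measurable fun y => g (ω, y) := hg.comp measurable_prodMk_left
  exact (lintegral_const_mul _ hslice).trans_le (mul_le_of_le_one_right' (hle ω))

theorem hasCondDistrib_state (hk : k < K) (hh : h ≤ M.H) :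
    HasCondDistrib (m𝓧 := 𝓖 k 0) (s k h) id
      (@stateKernel S A Ω _ _ (𝓖 k 0) M 0 h (fun ω => greedy (f k ω)) (fun _ => M.s₁)
        (run.measurable_policy k hk) measurable_const (by omega)) Pr := by
  have hstate : Measurable (s k h) := (run.measurable_state k hk h hh).mono (run.le k h) le_rfl
  refine @hasCondDistrib_of_forall_measure_inter Ω Ω S _ (𝓖 k 0) _ Pr _ id _ _
    (@isMarkovKernel_stateKernel ..) (measurable_id'' (run.le k 0)) hstate fun E hE B hB => ?_
  have hE' : MeasurableSet E := run.le k 0 E hE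
  have hind : Measurable[(𝓖 k 0).prod inferInstance]
      ((E ×ˢ B).indicator fun _ : Ω × S => (1 : ENNReal)) :=
    measurable_const.indicator (MeasurableSet.prod hE hB)
  calc Pr (E ∩ s k h ⁻¹' B)
      = ∫⁻ ω, (E ×ˢ B).indicator (fun _ => 1) (ω, s k h ω) ∂Pr := by
        rw [← lintegral_indicator_one (hE'.inter (hstate hB))]
        rfl
    _ = ∫⁻ ω, ∫⁻ y, (E ×ˢ B).indicator (fun _ => 1) (ω, y)
          ∂stateLaw M (greedy (f k ω)) 0 M.s₁ h ∂Pr := run.lintegral_state hk hh hind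
    _ = ∫⁻ ω in E, stateLaw M (greedy (f k ω)) 0 M.s₁ h B ∂Pr := by
        rw [← lintegral_indicator hE']
        refine lintegral_congr fun ω => ?_
        by_cases hω : ω ∈ E
        · rw [Set.indicator_of_mem hω, ← lintegral_indicator_one hB]
          exact lintegral_congr fun y => by by_cases hy : y ∈ B <;> simp [hω, hy]
        · simp [hω]

theorem integral_state (hk : k < K) (hh : h ≤ M.H) {g : Ω × S → ℝ}
    (hg : Measurable[(𝓖 k 0).prod inferInstance] g) {a b : ℝ} (hab : ∀ p, g p ∈ Set.Icc a b) :
    ∫ ω, g (ω, s k h ω) ∂Pr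
      = ∫ ω, ∫ y, g (ω, y) ∂stateLaw M (greedy (f k ω)) 0 M.s₁ h ∂Pr :=
  @integral_of_hasCondDistrib Ω Ω S _ (𝓖 k 0) _ Pr _ id _ _ (@isMarkovKernel_stateKernel ..)
    (run.hasCondDistrib_state hk hh) (measurable_id'' (run.le k 0)) g hg a b hab

end IsRun

end Run

section Exponential

theorem ofReal_exp_add (x y : ℝ) : ENNReal.ofReal (Real.exp (x + y))
    = ENNReal.ofReal (Real.exp x) * ENNReal.ofReal (Real.exp y) := by
  rw [Real.exp_add, ENNReal.ofReal_mul (Real.exp_pos x).le]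

theorem exp_neg_div_four_le {u : ℝ} (hu : u ∈ Set.Icc (0 : ℝ) 1) :
    Real.exp (-u / 4) ≤ 1 - u / 5 := by
  obtain ⟨h0, h1⟩ := hu
  have hexp : 1 + u / 4 ≤ Real.exp (u / 4) := by linarith [Real.add_one_le_exp (u / 4)]
  rw [neg_div, Real.exp_neg]
  refine (inv_anti₀ (by positivity) hexp).trans ?_
  rw [inv_le_iff_one_le_mul₀ (by positivity)]
  nlinarith

theorem lintegral_exp_mean_sub_le_one {α : Type*} [MeasurableSpace α] {μ : Measure α}
    [IsProbabilityMeasure μ] {U : α → ℝ} (hU : AEMeasurable U μ)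
    (h01 : ∀ x, U x ∈ Set.Icc (0 : ℝ) 1) :
    ∫⁻ x, ENNReal.ofReal (Real.exp ((∫ x, U x ∂μ) / 5 - U x / 4)) ∂μ ≤ 1 := by
  have hint : Integrable U μ := Integrable.of_mem_Icc 0 1 hU (ae_of_all _ h01)
  set m := ∫ x, U x ∂μ with hm
  have hpointwise : ∀ x, Real.exp (m / 5 - U x / 4) ≤ Real.exp (m / 5) * (1 - U x / 5) :=
      fun x => by
    rw [sub_eq_add_neg, Real.exp_add, ← neg_div]
    exact mul_le_mul_of_nonneg_left (exp_neg_div_four_le (h01 x)) (Real.exp_pos _).le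
  calc ∫⁻ x, ENNReal.ofReal (Real.exp (m / 5 - U x / 4)) ∂μ
      ≤ ∫⁻ x, ENNReal.ofReal (Real.exp (m / 5) * (1 - U x / 5)) ∂μ :=
        lintegral_mono fun x => ENNReal.ofReal_le_ofReal (hpointwise x)
    _ = ENNReal.ofReal (∫ x, Real.exp (m / 5) * (1 - U x / 5) ∂μ) :=
        (ofReal_integral_eq_lintegral_ofReal
          (((integrable_const _).sub (hint.div_const 5)).const_mul _)
          (ae_of_all _ fun x => (Real.exp_pos _).le.trans (hpointwise x))).symm
    _ = ENNReal.ofReal (Real.exp (m / 5) * (1 - m / 5)) := by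
        rw [integral_const_mul, integral_sub (integrable_const _) (hint.div_const 5), integral_div]
        simp [hm]
    _ ≤ ENNReal.ofReal (Real.exp (m / 5) * Real.exp (-(m / 5))) := by
        gcongr
        linarith [Real.add_one_le_exp (-(m / 5))]
    _ = 1 := by rw [← Real.exp_add, add_neg_cancel, Real.exp_zero, ENNReal.ofReal_one]

end Exponential

section Excess

variable {S A : Type*} [MeasurableSpace S] [MeasurableSpace A] {M : MDP S A}
  {F G : ℕ → Set (S × A → ℝ)} {greedy : QTuple S A → ℕ → S → A} {q ζ : QTuple S A} {h : ℕ}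

/-- The excess at one transition of the squared loss of `q_h` over that of `T_h ζ_{h+1}`, both as
predictors of the regression target `r_h + max ζ_{h+1}`. -/
def excess (M : MDP S A) (q ζ : QTuple S A) (h : ℕ) (x : S × A) (y : S) : ℝ :=
  (q h x - M.r h x - ⨆ a, ζ (h + 1) (y, a)) ^ 2
    - (bellman M h (ζ (h + 1)) x - M.r h x - ⨆ a, ζ (h + 1) (y, a)) ^ 2

theorem excess_eq (q ζ : QTuple S A) (h : ℕ) (x : S × A) (y : S) :
    excess M q ζ h x y = bellmanError M q ζ h x ^ 2 - 2 * bellmanError M q ζ h x *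
      ((⨆ a, ζ (h + 1) (y, a)) - ∫ y, (⨆ a, ζ (h + 1) (y, a)) ∂M.P h x) := by
  unfold excess bellmanError bellman
  ring

namespace Setting

variable (hs : Setting M F G greedy)
include hs

theorem measurable_excess (hq : q ∈ tuples M.H F ∪ tuples M.H G) (hζ : ζ ∈ tuples M.H F)
    (hh : h < M.H) : Measurable fun p : (S × A) × S => excess M q ζ h p.1 p.2 := by
  have hfst : Measurable (Prod.fst : (S × A) × S → S × A) := measurable_fst
  have htarget := (hs.measurable_iSup hζ (h + 1)).comp
    (measurable_snd : Measurable (Prod.snd : (S × A) × S → S))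
  have hreward := (M.measurable_r h).comp hfst
  have hbellman := (hs.measurable_bellman hζ hh).comp hfst
  have hpred := (hs.measurable_of_mem_union hq h).comp hfst
  exact (((hpred.sub hreward).sub htarget).pow_const 2).sub
    (((hbellman.sub hreward).sub htarget).pow_const 2)

/- By `excess_eq` the excess is affine in the centred target, which is sub-Gaussian with variance
proxy `1/4` by Hoeffding's lemma. -/
theorem lintegral_exp_neg_excess_le_one (q : QTuple S A) (hζ : ζ ∈ tuples M.H F) (h : ℕ)
    (x : S × A) :
    ∫⁻ y, ENNReal.ofReal (Real.exp (-excess M q ζ h x y + bellmanError M q ζ h x ^ 2 / 2))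
      ∂M.P h x ≤ 1 := by
  have hsub := hasSubgaussianMGF_of_mem_Icc (μ := M.P h x)
    (hs.measurable_iSup hζ (h + 1)).aemeasurable (ae_of_all _ (hs.iSup_mem_Icc hζ (h + 1)))
  set e := bellmanError M q ζ h x with he
  have hexp : ∀ y, Real.exp (-excess M q ζ h x y + e ^ 2 / 2)
      = Real.exp (-(e ^ 2 / 2)) * Real.exp (2 * e *
        ((⨆ a, ζ (h + 1) (y, a)) - ∫ y, (⨆ a, ζ (h + 1) (y, a)) ∂M.P h x)) := fun y => by
    rw [excess_eq, ← he, ← Real.exp_add]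
    ring_nf
  have hmgf : mgf (fun y => (⨆ a, ζ (h + 1) (y, a)) - ∫ y, (⨆ a, ζ (h + 1) (y, a)) ∂M.P h x)
      (M.P h x) (2 * e) ≤ Real.exp (e ^ 2 / 2) := by
    refine (hsub.mgf_le (2 * e)).trans_eq ?_
    norm_num
    ring
  simp_rw [hexp]
  rw [← ofReal_integral_eq_lintegral_ofReal ((hsub.integrable_exp_mul (2 * e)).const_mul _)
    (ae_of_all _ fun y => by positivity), integral_const_mul, ENNReal.ofReal_le_one, Real.exp_neg]
  exact (inv_mul_le_one₀ (Real.exp_pos _)).mpr hmgf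

theorem bellmanError_sq_mem_Icc (hq : q ∈ tuples M.H F ∪ tuples M.H G) (hζ : ζ ∈ tuples M.H F)
    (hh : h < M.H) (x : S × A) : bellmanError M q ζ h x ^ 2 ∈ Set.Icc (0 : ℝ) 1 :=
  ⟨sq_nonneg _, (sq_le_one_iff_abs_le_one _).mpr (abs_le.mpr (hs.bellmanError_mem_Icc hq hζ hh x))⟩

end Setting

end Excess

section Supermartingale

variable {Ω S A : Type*} [MeasurableSpace S] [MeasurableSpace A] [MeasurableSpace Ω]
  {Pr : Measure Ω} {M : MDP S A} {F G : ℕ → Set (S × A → ℝ)}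
  {greedy : QTuple S A → ℕ → S → A} {K : ℕ} {β : ℝ} {𝓖 : ℕ → ℕ → MeasurableSpace Ω}
  {s : ℕ → ℕ → Ω → S} {f : ℕ → Ω → QTuple S A} {q ζ : QTuple S A} {k h : ℕ}

/-- The mean of the squared Bellman error of `(q, ζ)` at step `h` along the greedy policy of `p`. -/
def meanSqError (M : MDP S A) (greedy : QTuple S A → ℕ → S → A) (q ζ : QTuple S A) (h : ℕ)
    (p : QTuple S A) : ℝ :=
  ∫ y, bellmanError M q ζ h (y, greedy p h y) ^ 2 ∂stateLaw M (greedy p) 0 M.s₁ h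

/-- The logarithm of the factor that episode `k` contributes to the exponential supermartingale. -/
def logWeight (M : MDP S A) (greedy : QTuple S A → ℕ → S → A) (s : ℕ → ℕ → Ω → S)
    (f : ℕ → Ω → QTuple S A) (q ζ : QTuple S A) (h k : ℕ) (ω : Ω) : ℝ :=
  -excess M q ζ h (visit greedy s f k h ω) (s k (h + 1) ω)
    + bellmanError M q ζ h (visit greedy s f k h ω) ^ 2 / 4
    + meanSqError M greedy q ζ h (f k ω) / 5

namespace IsRun

variable (run : IsRun Pr M F G greedy K β 𝓖 s f) (hs : Setting M F G greedy)
  (hq : q ∈ tuples M.H F ∪ tuples M.H G) (hζ : ζ ∈ tuples M.H F) (hh : h < M.H)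
include run hs hq hζ hh

theorem measurable_bellmanError_greedy (hk : k < K) :
    Measurable[(𝓖 k 0).prod inferInstance] fun p : Ω × S =>
      bellmanError M q ζ h (p.2, greedy (f k p.1) h p.2) :=
  (hs.measurable_bellmanError hq hζ hh).comp
    (Measurable.prodMk measurable_snd (run.measurable_policy k hk h hh))

theorem measurable_bellmanError_visit (hk : k < K) :
    Measurable[𝓖 k h] fun ω => bellmanError M q ζ h (visit greedy s f k h ω) :=
  (hs.measurable_bellmanError hq hζ hh).comp (run.measurable_visit hk hh)

theorem measurable_meanSqError (hk : k < K) :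
    Measurable[𝓖 k 0] fun ω => meanSqError M greedy q ζ h (f k ω) :=
  @measurable_integral_stateLaw S A Ω _ _ (𝓖 k 0) M 0 h (fun ω => greedy (f k ω))
    (fun _ => M.s₁) (run.measurable_policy k hk) measurable_const (by omega) _
    ((run.measurable_bellmanError_greedy hs hq hζ hh hk).pow_const 2)

theorem measurable_logWeight (hk : k < K) :
    Measurable[𝓖 k (h + 1)] (logWeight M greedy s f q ζ h k) := by
  have hvisit : Measurable[𝓖 k (h + 1)] (visit greedy s f k h) :=
    (run.measurable_visit hk hh).mono (run.mono_step k hk h hh) le_rfl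
  have hexcess : Measurable[𝓖 k (h + 1)] fun ω =>
      excess M q ζ h (visit greedy s f k h ω) (s k (h + 1) ω) :=
    (hs.measurable_excess hq hζ hh).comp (hvisit.prodMk (run.measurable_state k hk (h + 1) hh))
  have herror : Measurable[𝓖 k (h + 1)] fun ω => bellmanError M q ζ h (visit greedy s f k h ω) :=
    (hs.measurable_bellmanError hq hζ hh).comp hvisit
  have hmean := (run.measurable_meanSqError hs hq hζ hh hk).mono
    (run.le_of_step_le hk (Nat.zero_le _) hh) le_rfl
  exact (hexcess.neg.add ((herror.pow_const 2).div_const 4)).add (hmean.div_const 5)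

theorem measurable_sum_logWeight (hk : k ≤ K) :
    Measurable[𝓖 k 0] fun ω => ∑ t ∈ Finset.range k, logWeight M greedy s f q ζ h t ω :=
  Finset.measurable_fun_sum _ fun t ht =>
    have htk : t < k := Finset.mem_range.mp ht
    (run.measurable_logWeight hs hq hζ hh (htk.trans_le hk)).mono (run.le_start_of_lt htk hk hh)
      le_rfl

variable [IsFiniteMeasure Pr]

theorem lintegral_mul_exp_neg_excess_le (hk : k < K) {W : Ω → ENNReal}
    (hW : Measurable[𝓖 k h] W) :
    ∫⁻ ω, W ω * ENNReal.ofReal (Real.exp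
        (-excess M q ζ h (visit greedy s f k h ω) (s k (h + 1) ω)
          + bellmanError M q ζ h (visit greedy s f k h ω) ^ 2 / 2)) ∂Pr
      ≤ ∫⁻ ω, W ω ∂Pr := by
  have herror := run.measurable_bellmanError_visit hs hq hζ hh hk
  have hexcess : Measurable[(𝓖 k h).prod inferInstance] fun p : Ω × S =>
      excess M q ζ h (visit greedy s f k h p.1) p.2 :=
    (hs.measurable_excess hq hζ hh).comp
      (((run.measurable_visit hk hh).comp measurable_fst).prodMk measurable_snd)
  have hfactor : Measurable[(𝓖 k h).prod inferInstance] fun p : Ω × S =>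
      ENNReal.ofReal (Real.exp (-excess M q ζ h (visit greedy s f k h p.1) p.2
        + bellmanError M q ζ h (visit greedy s f k h p.1) ^ 2 / 2)) :=
    (hexcess.neg.add (((herror.pow_const 2).div_const 2).comp measurable_fst)).exp.ennreal_ofReal
  exact run.lintegral_mul_next_state_le hk hh hW hfactor fun ω =>
    hs.lintegral_exp_neg_excess_le_one q hζ h _

theorem lintegral_mul_exp_meanSqError_le (hk : k < K) {W : Ω → ENNReal}
    (hW : Measurable[𝓖 k 0] W) :
    ∫⁻ ω, W ω * ENNReal.ofReal (Real.exp (meanSqError M greedy q ζ h (f k ω) / 5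
        - bellmanError M q ζ h (visit greedy s f k h ω) ^ 2 / 4)) ∂Pr
      ≤ ∫⁻ ω, W ω ∂Pr := by
  have hmean := run.measurable_meanSqError hs hq hζ hh hk
  have herror := run.measurable_bellmanError_greedy hs hq hζ hh hk
  have hfactor : Measurable[(𝓖 k 0).prod inferInstance] fun p : Ω × S =>
      ENNReal.ofReal (Real.exp (meanSqError M greedy q ζ h (f k p.1) / 5
        - bellmanError M q ζ h (p.2, greedy (f k p.1) h p.2) ^ 2 / 4)) :=
    (((hmean.div_const 5).comp measurable_fst).sub
      ((herror.pow_const 2).div_const 4)).exp.ennreal_ofReal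
  refine run.lintegral_mul_state_le hk hh.le hW hfactor fun ω => ?_
  have := isProbabilityMeasure_stateLaw (M := M) (h := 0) (n := h)
    (fun i _ => hs.measurable_greedy (run.mem k hk ω) i) (by omega) M.s₁
  exact lintegral_exp_mean_sub_le_one
    ((herror.comp measurable_prodMk_left).pow_const 2).aemeasurable
    fun y => hs.bellmanError_sq_mem_Icc hq hζ hh _

theorem lintegral_mul_exp_logWeight_le (hk : k < K) {W : Ω → ENNReal}
    (hW : Measurable[𝓖 k 0] W) :
    ∫⁻ ω, W ω * ENNReal.ofReal (Real.exp (logWeight M greedy s f q ζ h k ω)) ∂Pr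
      ≤ ∫⁻ ω, W ω ∂Pr := by
  have hle : 𝓖 k 0 ≤ 𝓖 k h := run.le_of_step_le hk (Nat.zero_le _) hh.le
  have hmean := (run.measurable_meanSqError hs hq hζ hh hk).mono hle le_rfl
  have herror := run.measurable_bellmanError_visit hs hq hζ hh hk
  have hfactor : Measurable[𝓖 k h] fun ω => ENNReal.ofReal (Real.exp
      (meanSqError M greedy q ζ h (f k ω) / 5
        - bellmanError M q ζ h (visit greedy s f k h ω) ^ 2 / 4)) :=
    ((hmean.div_const 5).sub ((herror.pow_const 2).div_const 4)).exp.ennreal_ofReal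
  refine le_trans (le_of_eq (lintegral_congr fun ω => ?_))
    ((run.lintegral_mul_exp_neg_excess_le hs hq hζ hh hk ((hW.mono hle le_rfl).mul hfactor)).trans
      (run.lintegral_mul_exp_meanSqError_le hs hq hζ hh hk hW))
  rw [Pi.mul_apply, mul_assoc, ← ofReal_exp_add, logWeight]
  ring_nf

theorem lintegral_exp_sum_logWeight_le (hk : k ≤ K) :
    ∫⁻ ω, ENNReal.ofReal (Real.exp (∑ t ∈ Finset.range k, logWeight M greedy s f q ζ h t ω)) ∂Pr
      ≤ Pr Set.univ := by
  induction k with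
  | zero => simp
  | succ k ih =>
    refine le_trans (le_of_eq (lintegral_congr fun ω => ?_))
      ((run.lintegral_mul_exp_logWeight_le hs hq hζ hh hk
        (run.measurable_sum_logWeight hs hq hζ hh (Nat.le_of_succ_le hk)).exp.ennreal_ofReal).trans
          (ih (Nat.le_of_succ_le hk)))
    rw [Finset.sum_range_succ, ofReal_exp_add]

theorem measure_sum_logWeight_ge_le (hk : k ≤ K) (τ : ℝ) :
    Pr {ω | τ ≤ ∑ t ∈ Finset.range k, logWeight M greedy s f q ζ h t ω}
      ≤ ENNReal.ofReal (Real.exp (-τ)) * Pr Set.univ := by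
  have hmeas := (run.measurable_sum_logWeight hs hq hζ hh hk).mono (run.le k 0) le_rfl
  have hmarkov := meas_ge_le_lintegral_div (μ := Pr) hmeas.exp.ennreal_ofReal.aemeasurable
    (ε := ENNReal.ofReal (Real.exp τ)) (by simp [Real.exp_pos]) ENNReal.ofReal_ne_top
  refine (measure_mono fun ω hω => ENNReal.ofReal_le_ofReal (Real.exp_le_exp.mpr hω)).trans
    (hmarkov.trans ?_)
  rw [Real.exp_neg, ENNReal.ofReal_inv_of_pos (Real.exp_pos _), mul_comm,
    ENNReal.div_eq_inv_mul, mul_comm]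
  gcongr
  exact run.lintegral_exp_sum_logWeight_le hs hq hζ hh hk

end IsRun

end Supermartingale

section Covers

variable {S A : Type*} {V X : Set (QTuple S A)} {ρ : ℝ} {N : ℕ}

theorem exists_cover_of_coverNum_le (hN : coverNum V ρ ≤ N) :
    ∃ C : Set (QTuple S A), C.encard ≤ N ∧ ∀ f ∈ V, ∃ g ∈ C, ∀ h x, |f h x - g h x| ≤ ρ := by
  have hlt : coverNum V ρ < (N + 1 : ℕ) := hN.trans_lt (by exact_mod_cast N.lt_succ_self)
  simp only [coverNum, iInf_lt_iff] at hlt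
  obtain ⟨C, ⟨-, hcover⟩, hcard⟩ := hlt
  exact ⟨C, ENat.lt_add_one_iff (ENat.natCast_ne_top N) |>.mp (by exact_mod_cast hcard), hcover⟩

theorem exists_subset_cover_of_coverNum_le (hN : coverNum V ρ ≤ N) (hX : X ⊆ V) :
    ∃ D ⊆ X, D.encard ≤ N ∧ ∀ f ∈ X, ∃ g ∈ D, ∀ h x, |f h x - g h x| ≤ 2 * ρ := by
  obtain ⟨C, hcard, hcover⟩ := exists_cover_of_coverNum_le hN
  choose! centre hmem hclose using hcover
  obtain ⟨D, hDX, hD⟩ := X.exists_subset_bijOn centre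
  refine ⟨D, hDX, ?_, fun f hf => ?_⟩
  · rw [← hD.injOn.encard_image]
    exact (Set.encard_le_encard (Set.image_subset_iff.mpr fun f hf => hmem f (hX (hDX hf)))).trans
      hcard
  · obtain ⟨g, hg, hgf⟩ := hD.surjOn (Set.mem_image_of_mem centre hf)
    refine ⟨g, hg, fun h x => (abs_sub_le _ (centre f h x) _).trans ?_⟩
    have hgx := hclose g (hX (hDX hg)) h x
    rw [hgf, abs_sub_comm] at hgx
    linarith [hclose f (hX hf) h x]

end Covers

section Perturbation

theorem abs_mul_sub_mul_le {a a' b b' η : ℝ} (ha' : |a'| ≤ 1) (hb : |b| ≤ 1)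
    (hηa : |a - a'| ≤ η) (hηb : |b - b'| ≤ η) : |a * b - a' * b'| ≤ 2 * η := by
  have hη : 0 ≤ η := (abs_nonneg _).trans hηa
  calc |a * b - a' * b'| = |(a - a') * b + a' * (b - b')| := by ring_nf
    _ ≤ |a - a'| * |b| + |a'| * |b - b'| := by
        rw [← abs_mul, ← abs_mul]
        exact abs_add_le _ _
    _ ≤ η * 1 + 1 * η := by gcongr
    _ = 2 * η := by ring

variable {Ω S A : Type*} [MeasurableSpace S] [MeasurableSpace A] {M : MDP S A}
  {F G : ℕ → Set (S × A → ℝ)} {greedy : QTuple S A → ℕ → S → A} {q q' ζ ζ' : QTuple S A} {h : ℕ}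
  {η : ℝ}

namespace Setting

variable (hs : Setting M F G greedy) (hq : q ∈ tuples M.H F ∪ tuples M.H G)
  (hq' : q' ∈ tuples M.H F ∪ tuples M.H G) (hζ : ζ ∈ tuples M.H F) (hζ' : ζ' ∈ tuples M.H F)
  (hh : h < M.H) (hη : ∀ x, |q h x - q' h x| ≤ η) (hηζ : ∀ x, |ζ (h + 1) x - ζ' (h + 1) x| ≤ η)
include hs hζ hζ' hη hηζ

theorem abs_bellmanError_sub_le (x : S × A) :
    |bellmanError M q ζ h x - bellmanError M q' ζ' h x| ≤ 2 * η := by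
  unfold bellmanError
  rw [sub_sub_sub_comm]
  exact (abs_sub _ _).trans
    (by linarith [hη x, hs.abs_bellman_sub_le hζ hζ' hηζ x])

include hq hq' hh

theorem abs_bellmanError_sq_sub_le (x : S × A) :
    |bellmanError M q ζ h x ^ 2 - bellmanError M q' ζ' h x ^ 2| ≤ 4 * η := by
  have hdiff := hs.abs_bellmanError_sub_le hζ hζ' hη hηζ x
  have := abs_mul_sub_mul_le (abs_le.mpr (hs.bellmanError_mem_Icc hq' hζ' hh x))
    (abs_le.mpr (hs.bellmanError_mem_Icc hq hζ hh x)) hdiff hdiff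
  rw [sq, sq]
  linarith

theorem abs_excess_sub_le (x : S × A) (y : S) :
    |excess M q ζ h x y - excess M q' ζ' h x y| ≤ 12 * η := by
  have hmean : ∀ {ζ}, ζ ∈ tuples M.H F →
      ∫ y, (⨆ a, ζ (h + 1) (y, a)) ∂M.P h x ∈ Set.Icc (0 : ℝ) 1 := fun hζ =>
    integral_mem_Icc (hs.measurable_iSup hζ (h + 1)).aemeasurable (hs.iSup_mem_Icc hζ (h + 1))
  have hmean_sub := abs_integral_sub_le (hs.integrable_iSup hζ (h + 1) (M.P h x))
    (hs.integrable_iSup hζ' (h + 1) (M.P h x)) (hs.abs_iSup_sub_le hζ hζ' hηζ)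
  have hcentred : |(⨆ a, ζ (h + 1) (y, a)) - ∫ y, (⨆ a, ζ (h + 1) (y, a)) ∂M.P h x| ≤ 1 := by
    simpa using abs_sub_le_of_le_of_le (hs.iSup_mem_Icc hζ (h + 1) y).1
      (hs.iSup_mem_Icc hζ (h + 1) y).2 (hmean hζ).1 (hmean hζ).2
  have hcentred_sub : |((⨆ a, ζ (h + 1) (y, a)) - ∫ y, (⨆ a, ζ (h + 1) (y, a)) ∂M.P h x)
      - ((⨆ a, ζ' (h + 1) (y, a)) - ∫ y, (⨆ a, ζ' (h + 1) (y, a)) ∂M.P h x)| ≤ 2 * η := by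
    rw [sub_sub_sub_comm]
    exact (abs_sub _ _).trans (by linarith [hs.abs_iSup_sub_le hζ hζ' hηζ y])
  have hsq := abs_le.mp (hs.abs_bellmanError_sq_sub_le hq hq' hζ hζ' hh hη hηζ x)
  have hprod := abs_le.mp (abs_mul_sub_mul_le (abs_le.mpr (hs.bellmanError_mem_Icc hq' hζ' hh x))
    hcentred (hs.abs_bellmanError_sub_le hζ hζ' hη hηζ x) hcentred_sub)
  rw [excess_eq, excess_eq]
  exact abs_le.mpr ⟨by linarith [hprod.2, hsq.1], by linarith [hprod.1, hsq.2]⟩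

theorem abs_meanSqError_sub_le {p : QTuple S A} (hp : p ∈ tuples M.H F) :
    |meanSqError M greedy q ζ h p - meanSqError M greedy q' ζ' h p| ≤ 4 * η := by
  have hπ := hs.measurable_greedy hp
  have := isProbabilityMeasure_stateLaw (M := M) (h := 0) (n := h) (fun i _ => hπ i) (by omega) M.s₁
  have hint : ∀ {q ζ}, q ∈ tuples M.H F ∪ tuples M.H G → ζ ∈ tuples M.H F →
      Integrable (fun y => bellmanError M q ζ h (y, greedy p h y) ^ 2)
        (stateLaw M (greedy p) 0 M.s₁ h) := fun hq hζ =>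
    Integrable.of_mem_Icc 0 1 (((hs.measurable_bellmanError hq hζ hh).comp
      (measurable_id.prodMk (hπ h))).pow_const 2).aemeasurable
      (ae_of_all _ fun y => hs.bellmanError_sq_mem_Icc hq hζ hh _)
  exact abs_integral_sub_le (hint hq hζ) (hint hq' hζ') fun y =>
    hs.abs_bellmanError_sq_sub_le hq hq' hζ hζ' hh hη hηζ _

theorem logWeight_le_add {s : ℕ → ℕ → Ω → S} {f : ℕ → Ω → QTuple S A} {k : ℕ} {ω : Ω}
    (hf : f k ω ∈ tuples M.H F) :
    logWeight M greedy s f q ζ h k ω ≤ logWeight M greedy s f q' ζ' h k ω + 14 * η := by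
  have hη₀ : 0 ≤ η := (abs_nonneg _).trans (hη (M.s₁, greedy 0 0 M.s₁))
  have hexcess := abs_le.mp (hs.abs_excess_sub_le hq hq' hζ hζ' hh hη hηζ
    (visit greedy s f k h ω) (s k (h + 1) ω))
  have hsq := abs_le.mp (hs.abs_bellmanError_sq_sub_le hq hq' hζ hζ' hh hη hηζ
    (visit greedy s f k h ω))
  have hmean := abs_le.mp (hs.abs_meanSqError_sub_le hq hq' hζ hζ' hh hη hηζ hf)
  unfold logWeight
  linarith [hexcess.1, hsq.2, hmean.2]

end Setting

end Perturbation

section Concentration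

variable {Ω S A : Type*} [MeasurableSpace S] [MeasurableSpace A] {M : MDP S A}
  {F G : ℕ → Set (S × A → ℝ)} {greedy : QTuple S A → ℕ → S → A} {ρ : ℝ} {N : ℕ}

/-- The pairs `(q, ζ)` at which the excess loss has to be controlled: `(f, f)` with `f ∈ F`, to
bound the Bellman errors of the chosen functions, and `(g, Q*)` with `g ∈ G`, to keep `Q*` in the
confidence sets. -/
def testPairs (M : MDP S A) (F G : ℕ → Set (S × A → ℝ)) : Set (QTuple S A × QTuple S A) :=
  (fun f => (f, f)) '' tuples M.H F ∪ (fun g => (g, qStarTuple M)) '' tuples M.H G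

/-- The event that all exponential supermartingales of the test pairs stay below `exp b`. -/
def Concentrated (M : MDP S A) (F G : ℕ → Set (S × A → ℝ)) (greedy : QTuple S A → ℕ → S → A)
    (K : ℕ) (s : ℕ → ℕ → Ω → S) (f : ℕ → Ω → QTuple S A) (b : ℝ) (ω : Ω) : Prop :=
  ∀ k < K, ∀ h < M.H, ∀ p ∈ testPairs M F G,
    ∑ t ∈ Finset.range k, logWeight M greedy s f p.1 p.2 h t ω ≤ b

theorem fst_mem_union_of_mem_testPairs {p : QTuple S A × QTuple S A} (hp : p ∈ testPairs M F G) :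
    p.1 ∈ tuples M.H F ∪ tuples M.H G := by
  rcases hp with ⟨f, hf, rfl⟩ | ⟨g, hg, rfl⟩
  exacts [Or.inl hf, Or.inr hg]

theorem Setting.snd_mem_tuples_of_mem_testPairs (hs : Setting M F G greedy)
    {p : QTuple S A × QTuple S A} (hp : p ∈ testPairs M F G) : p.2 ∈ tuples M.H F := by
  rcases hp with ⟨f, hf, rfl⟩ | ⟨g, -, rfl⟩
  exacts [hf, hs.qStarTuple_mem]

theorem exists_cover_testPairs (hρ : 0 ≤ ρ) (hN : coverNum (tuples M.H F ∪ tuples M.H G) ρ ≤ N) :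
    ∃ D : Finset (QTuple S A × QTuple S A), ↑D ⊆ testPairs M F G ∧ D.card ≤ 2 * N ∧
      ∀ p ∈ testPairs M F G, ∃ p' ∈ D, ∀ h x,
        |p.1 h x - p'.1 h x| ≤ 2 * ρ ∧ |p.2 h x - p'.2 h x| ≤ 2 * ρ := by
  obtain ⟨DF, hDF, hcardF, hcoverF⟩ :=
    exists_subset_cover_of_coverNum_le hN Set.subset_union_left
  obtain ⟨DG, hDG, hcardG, hcoverG⟩ :=
    exists_subset_cover_of_coverNum_le hN Set.subset_union_right
  let D := (fun f => (f, f)) '' DF ∪ (fun g => (g, qStarTuple M)) '' DG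
  have hcard : D.encard ≤ (2 * N : ℕ) := by
    push_cast
    rw [two_mul]
    exact (Set.encard_union_le _ _).trans (add_le_add ((Set.encard_image_le _ _).trans hcardF)
      ((Set.encard_image_le _ _).trans hcardG))
  have hfin : D.Finite := Set.finite_of_encard_le_coe hcard
  refine ⟨hfin.toFinset, ?_, ?_, ?_⟩
  · rw [hfin.coe_toFinset]
    exact Set.union_subset_union (Set.image_mono hDF) (Set.image_mono hDG)
  · rw [hfin.encard_eq_coe_toFinset_card] at hcard
    exact_mod_cast hcard
  · rintro _ (⟨f, hf, rfl⟩ | ⟨g, hg, rfl⟩)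
    · obtain ⟨f', hf', hclose⟩ := hcoverF f hf
      exact ⟨(f', f'), hfin.mem_toFinset.mpr (Or.inl ⟨f', hf', rfl⟩),
        fun h x => ⟨hclose h x, hclose h x⟩⟩
    · obtain ⟨g', hg', hclose⟩ := hcoverG g hg
      exact ⟨(g', qStarTuple M), hfin.mem_toFinset.mpr (Or.inr ⟨g', hg', rfl⟩),
        fun h x => ⟨hclose h x, by simpa using hρ⟩⟩

namespace IsRun

variable [MeasurableSpace Ω] {Pr : Measure Ω} {K : ℕ} {β : ℝ} {𝓖 : ℕ → ℕ → MeasurableSpace Ω}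
  {s : ℕ → ℕ → Ω → S} {f : ℕ → Ω → QTuple S A} (run : IsRun Pr M F G greedy K β 𝓖 s f)
  (hs : Setting M F G greedy)
include run hs

theorem concentrated_of_forall_cover_lt (hρ : 0 ≤ ρ) {D : Finset (QTuple S A × QTuple S A)}
    (hD : ↑D ⊆ testPairs M F G)
    (hcover : ∀ p ∈ testPairs M F G, ∃ p' ∈ D, ∀ h x,
      |p.1 h x - p'.1 h x| ≤ 2 * ρ ∧ |p.2 h x - p'.2 h x| ≤ 2 * ρ) {τ : ℝ} {ω : Ω}
    (hlt : ∀ k < K, ∀ h < M.H, ∀ p ∈ D,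
      ∑ t ∈ Finset.range k, logWeight M greedy s f p.1 p.2 h t ω < τ) :
    Concentrated M F G greedy K s f (τ + 28 * K * ρ) ω := by
  intro k hk h hh p hp
  obtain ⟨p', hp', hclose⟩ := hcover p hp
  have hkK : (k : ℝ) * ρ ≤ K * ρ := by gcongr
  calc ∑ t ∈ Finset.range k, logWeight M greedy s f p.1 p.2 h t ω
      ≤ ∑ t ∈ Finset.range k, (logWeight M greedy s f p'.1 p'.2 h t ω + 14 * (2 * ρ)) :=
        Finset.sum_le_sum fun t ht =>
          hs.logWeight_le_add (fst_mem_union_of_mem_testPairs hp)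
            (fst_mem_union_of_mem_testPairs (hD hp')) (hs.snd_mem_tuples_of_mem_testPairs hp)
            (hs.snd_mem_tuples_of_mem_testPairs (hD hp')) hh (fun x => (hclose h x).1)
            (fun x => (hclose (h + 1) x).2) (run.mem t ((Finset.mem_range.mp ht).trans hk) ω)
    _ = ∑ t ∈ Finset.range k, logWeight M greedy s f p'.1 p'.2 h t ω + 28 * (k * ρ) := by
        rw [Finset.sum_add_distrib, Finset.sum_const, Finset.card_range, nsmul_eq_mul]
        ring
    _ ≤ τ + 28 * K * ρ := by linarith [hlt k hk h hh p' hp']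

theorem measureReal_not_concentrated_le [IsProbabilityMeasure Pr] (hρ : 0 ≤ ρ)
    (hN : coverNum (tuples M.H F ∪ tuples M.H G) ρ ≤ N) (τ : ℝ) :
    Pr.real {ω | ¬Concentrated M F G greedy K s f (τ + 28 * K * ρ) ω}
      ≤ 2 * (N * (M.H * K)) * Real.exp (-τ) := by
  obtain ⟨D, hD, hcard, hcover⟩ := exists_cover_testPairs hρ hN
  let I := Finset.range K ×ˢ Finset.range M.H ×ˢ D
  let bad : ℕ × ℕ × QTuple S A × QTuple S A → Set Ω := fun i =>
    {ω | τ ≤ ∑ t ∈ Finset.range i.1, logWeight M greedy s f i.2.2.1 i.2.2.2 i.2.1 t ω}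
  have hsub : {ω | ¬Concentrated M F G greedy K s f (τ + 28 * K * ρ) ω} ⊆ ⋃ i ∈ I, bad i := by
    intro ω hω
    contrapose! hω
    refine not_not.mpr (run.concentrated_of_forall_cover_lt hs hρ hD hcover
      fun k hk h hh p hp => not_le.mp fun hle => hω ?_)
    exact Set.mem_biUnion (x := (k, h, p)) (by simp [I, hk, hh, hp]) hle
  have hbad : ∀ i ∈ I, Pr.real (bad i) ≤ Real.exp (-τ) := by
    rintro ⟨k, h, p⟩ hi
    simp only [I, Finset.mem_product, Finset.mem_range] at hi
    obtain ⟨hk, hh, hp⟩ := hi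
    have hle := run.measure_sum_logWeight_ge_le hs (fst_mem_union_of_mem_testPairs (hD hp))
      (hs.snd_mem_tuples_of_mem_testPairs (hD hp)) hh hk.le τ
    rw [measure_univ, mul_one] at hle
    exact ENNReal.toReal_le_of_le_ofReal (Real.exp_pos _).le hle
  have hcardI : (I.card : ℝ) ≤ 2 * (N * (M.H * K)) := by
    have : I.card ≤ K * (M.H * (2 * N)) := by
      simp only [I, Finset.card_product, Finset.card_range]
      gcongr
    calc (I.card : ℝ) ≤ (K * (M.H * (2 * N)) : ℕ) := by exact_mod_cast this
      _ = 2 * (N * (M.H * K)) := by push_cast; ring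
  calc Pr.real {ω | ¬Concentrated M F G greedy K s f (τ + 28 * K * ρ) ω}
      ≤ ∑ i ∈ I, Pr.real (bad i) :=
        (measureReal_mono hsub (measure_ne_top _ _)).trans (measureReal_biUnion_finset_le _ _)
    _ ≤ I.card • Real.exp (-τ) := Finset.sum_le_card_nsmul _ _ _ hbad
    _ ≤ 2 * (N * (M.H * K)) * Real.exp (-τ) := by
        rw [nsmul_eq_mul]
        gcongr

end IsRun

end Concentration

section ConfidenceSets

theorem exists_mem_tuples_apply_eq {S A : Type*} {H h : ℕ} {G : ℕ → Set (S × A → ℝ)}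
    (hG : ∀ h < H, (G h).Nonempty) (hh : h < H) {g : S × A → ℝ} (hg : g ∈ G h) :
    ∃ q ∈ tuples H G, q h = g := by
  have hne : ∀ i, ∃ u, u ∈ withTerminal H G i := fun i => by
    unfold withTerminal
    split_ifs with hi
    exacts [hG i hi, ⟨0, rfl⟩]
  choose q hq using hne
  refine ⟨Function.update q h g, fun i => ?_, Function.update_self ..⟩
  rcases eq_or_ne i h with rfl | hi
  · simpa [withTerminal, hh] using hg
  · simpa [Function.update_of_ne hi] using hq i

variable {Ω S A : Type*} [MeasurableSpace S] [MeasurableSpace A] {M : MDP S A}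
  {F G : ℕ → Set (S × A → ℝ)} {greedy : QTuple S A → ℕ → S → A} {K k h : ℕ} {β : ℝ}
  {s : ℕ → ℕ → Ω → S} {f : ℕ → Ω → QTuple S A} {ω : Ω}

theorem meanSqError_nonneg (q ζ p : QTuple S A) (h : ℕ) : 0 ≤ meanSqError M greedy q ζ h p :=
  integral_nonneg fun _ => sq_nonneg _

theorem sum_logWeight_eq (q ζ : QTuple S A) (h k : ℕ) :
    ∑ t ∈ Finset.range k, logWeight M greedy s f q ζ h t ω
      = loss M (fun i h => s i h ω) (action greedy s f ω) k h
          (bellman M h (ζ (h + 1))) (ζ (h + 1))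
        - loss M (fun i h => s i h ω) (action greedy s f ω) k h (q h) (ζ (h + 1))
        + (∑ t ∈ Finset.range k, bellmanError M q ζ h (visit greedy s f t h ω) ^ 2) / 4
        + (∑ t ∈ Finset.range k, meanSqError M greedy q ζ h (f t ω)) / 5 := by
  simp only [logWeight, loss, excess, visit, neg_sub, Finset.sum_add_distrib,
    Finset.sum_sub_distrib, Finset.sum_div]

theorem Setting.qStarTuple_mem_confSet (hs : Setting M F G greedy)
    (hc : Concentrated M F G greedy K s f β ω) (hk : k < K) :
    qStarTuple M ∈ confSet M F G β (fun i h => s i h ω) (action greedy s f ω) k := by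
  refine ⟨hs.qStarTuple_mem, fun h hh => ?_⟩
  have hG : ∀ i < M.H, (G i).Nonempty := fun i hi => ⟨_, hs.bellman_mem hs.qStarTuple_mem hi⟩
  have : Nonempty (G h) := (hG h hh).to_subtype
  rw [← sub_le_iff_le_add]
  refine le_ciInf fun ⟨g, hg⟩ => ?_
  obtain ⟨q, hq, rfl⟩ := exists_mem_tuples_apply_eq hG hh hg
  have hsum := hc k hk h hh (q, qStarTuple M) (Or.inr ⟨q, hq, rfl⟩)
  rw [sum_logWeight_eq, hs.bellman_qStar hh] at hsum
  have herror : 0 ≤ ∑ t ∈ Finset.range k,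
      bellmanError M q (qStarTuple M) h (visit greedy s f t h ω) ^ 2 :=
    Finset.sum_nonneg fun _ _ => sq_nonneg _
  have hmean : 0 ≤ ∑ t ∈ Finset.range k, meanSqError M greedy q (qStarTuple M) h (f t ω) :=
    Finset.sum_nonneg fun _ _ => meanSqError_nonneg ..
  linarith

namespace IsRun

variable [MeasurableSpace Ω] {Pr : Measure Ω} {𝓖 : ℕ → ℕ → MeasurableSpace Ω}
  (run : IsRun Pr M F G greedy K β 𝓖 s f) (hs : Setting M F G greedy)
  (hc : Concentrated M F G greedy K s f β ω) (hk : k < K)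
include run hs hc hk

theorem mem_confSet :
    f k ω ∈ confSet M F G β (fun i h => s i h ω) (action greedy s f ω) k :=
  (run.optimistic k hk ω ⟨_, hs.qStarTuple_mem_confSet hc hk⟩).1

theorem vStar_le_of_concentrated : vStar M 0 M.s₁ ≤ ⨆ a, f k ω 0 (M.s₁, a) := by
  have hmem := hs.qStarTuple_mem_confSet hc hk
  calc vStar M 0 M.s₁ ≤ ⨆ a, qStarTuple M 0 (M.s₁, a) := hs.vStar_le_iSup_qStar 0 M.s₁
    _ = qStarTuple M 0 (M.s₁, greedy (qStarTuple M) 0 M.s₁) :=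
        hs.iSup_eq_greedy hs.qStarTuple_mem 0 M.s₁
    _ ≤ f k ω 0 (M.s₁, greedy (f k ω) 0 M.s₁) := (run.optimistic k hk ω ⟨_, hmem⟩).2 _ hmem
    _ = ⨆ a, f k ω 0 (M.s₁, a) := (hs.iSup_eq_greedy (run.mem k hk ω) 0 M.s₁).symm

variable (hh : h < M.H)
include hh

theorem sum_errors_le :
    (∑ t ∈ Finset.range k, bellmanError M (f k ω) (f k ω) h (visit greedy s f t h ω) ^ 2) / 4
      + (∑ t ∈ Finset.range k, meanSqError M greedy (f k ω) (f k ω) h (f t ω)) / 5 ≤ 2 * β := by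
  have hF := run.mem k hk ω
  have hsum := hc k hk h hh (f k ω, f k ω) (Or.inl ⟨_, hF, rfl⟩)
  rw [sum_logWeight_eq] at hsum
  have hconf := (run.mem_confSet hs hc hk).2 h hh
  have hinf : ⨅ g : G h, loss M (fun i h => s i h ω) (action greedy s f ω) k h g (f k ω (h + 1))
      ≤ loss M (fun i h => s i h ω) (action greedy s f ω) k h
          (bellman M h (f k ω (h + 1))) (f k ω (h + 1)) := by
    refine ciInf_le (f := fun g : G h => loss M (fun i h => s i h ω) (action greedy s f ω) k h g
      (f k ω (h + 1))) ⟨0, ?_⟩ ⟨_, hs.bellman_mem hF hh⟩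
    rintro _ ⟨g, rfl⟩
    exact Finset.sum_nonneg fun _ _ => sq_nonneg _
  linarith

theorem sum_bellmanError_visit_sq_le :
    ∑ t ∈ Finset.range k, bellmanError M (f k ω) (f k ω) h (visit greedy s f t h ω) ^ 2
      ≤ 10 * β := by
  have hmean : 0 ≤ ∑ t ∈ Finset.range k, meanSqError M greedy (f k ω) (f k ω) h (f t ω) :=
    Finset.sum_nonneg fun _ _ => meanSqError_nonneg ..
  have herror : 0 ≤ ∑ t ∈ Finset.range k,
      bellmanError M (f k ω) (f k ω) h (visit greedy s f t h ω) ^ 2 :=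
    Finset.sum_nonneg fun _ _ => sq_nonneg _
  linarith [run.sum_errors_le hs hc hk hh]

theorem sum_meanSqError_le :
    ∑ t ∈ Finset.range k, meanSqError M greedy (f k ω) (f k ω) h (f t ω) ≤ 10 * β := by
  have herror : 0 ≤ ∑ t ∈ Finset.range k,
      bellmanError M (f k ω) (f k ω) h (visit greedy s f t h ω) ^ 2 :=
    Finset.sum_nonneg fun _ _ => sq_nonneg _
  linarith [run.sum_errors_le hs hc hk hh]

end IsRun

end ConfidenceSets

section Integrals

variable {Ω : Type*} [MeasurableSpace Ω] {Pr : Measure Ω} [IsProbabilityMeasure Pr]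

theorem integral_le_add_mul_measureReal {X : Ω → ℝ} (hX : Integrable X Pr) {B : Set Ω} {a c : ℝ}
    (hgood : ∀ ω ∉ B, X ω ≤ a) (hall : ∀ ω, X ω ≤ a + c) :
    ∫ ω, X ω ∂Pr ≤ a + c * Pr.real B := by
  set T := toMeasurable Pr B
  have hT : MeasurableSet T := measurableSet_toMeasurable Pr B
  have hpt : ∀ ω, X ω ≤ a + T.indicator (fun _ => c) ω := fun ω => by
    by_cases hω : ω ∈ T
    · simpa only [Set.indicator_of_mem hω] using hall ω
    · simpa only [Set.indicator_of_notMem hω, add_zero] using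
        hgood ω fun hB => hω (subset_toMeasurable Pr B hB)
  have hind : Integrable (T.indicator fun _ => c) Pr := (integrable_const c).indicator hT
  calc ∫ ω, X ω ∂Pr ≤ ∫ ω, (a + T.indicator (fun _ => c) ω) ∂Pr :=
        integral_mono hX ((integrable_const a).add hind) hpt
    _ = a + c * Pr.real B := by
        rw [integral_add (integrable_const a) hind, integral_indicator_const c hT]
        simp [T, measureReal_def, measure_toMeasurable, mul_comm]

end Integrals

section Regret

variable {Ω S A : Type*} [MeasurableSpace S] [MeasurableSpace A] {M : MDP S A}
  {F G : ℕ → Set (S × A → ℝ)} {greedy : QTuple S A → ℕ → S → A} {K k h d : ℕ} {β η : ℝ}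
  {s : ℕ → ℕ → Ω → S} {f : ℕ → Ω → QTuple S A} {q : QTuple S A} {ω : Ω}

/-- The suboptimality of the greedy policy of `q`. -/
def regret (M : MDP S A) (greedy : QTuple S A → ℕ → S → A) (q : QTuple S A) : ℝ :=
  vStar M 0 M.s₁ - value M (greedy q) 0 M.s₁

/-- The mean Bellman residual of `q` at step `h` along the greedy policy of `q` itself. -/
def meanBellmanError (M : MDP S A) (greedy : QTuple S A → ℕ → S → A) (h : ℕ) (q : QTuple S A) :
    ℝ :=
  ∫ x, bellmanError M q q h x ∂occupancy M (greedy q) h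

theorem dimDE_le_dimBE {D : ℕ → Set (Measure (S × A))} (hh : h < M.H) :
    dimDE (residuals M F h) (D h) η ≤ dimBE M F D η :=
  le_iSup₂ (f := fun h (_ : h < M.H) => dimDE (residuals M F h) (D h) η) h hh

namespace Setting

variable (hs : Setting M F G greedy)
include hs

theorem regret_mem_Icc (hq : q ∈ tuples M.H F) : regret M greedy q ∈ Set.Icc (0 : ℝ) 1 := by
  have hopt := hs.value_le_vStar (hs.measurable_greedy hq) 0 M.s₁
  have hvalue := (value_mem_Icc (h := 0) (fun i _ => hs.measurable_greedy hq i)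
    (fun _ => hs.reward_le_one) M.s₁).1
  have hvStar : vStar M 0 M.s₁ ≤ 1 :=
    (hs.vStar_le_iSup_qStar 0 M.s₁).trans (hs.iSup_mem_Icc hs.qStarTuple_mem 0 M.s₁).2
  unfold regret
  exact ⟨by linarith, by linarith⟩

theorem meanBellmanError_eq_integral_stateLaw (hq : q ∈ tuples M.H F) (hh : h < M.H) :
    meanBellmanError M greedy h q
      = ∫ y, bellmanError M q q h (y, greedy q h y) ∂stateLaw M (greedy q) 0 M.s₁ h :=
  integral_occupancy (hs.measurable_greedy hq h) (hs.measurable_bellmanError (Or.inl hq) hq hh)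

theorem meanBellmanError_mem_Icc (hq : q ∈ tuples M.H F) (hh : h < M.H) :
    meanBellmanError M greedy h q ∈ Set.Icc (-1 : ℝ) 1 :=
  have := isProbabilityMeasure_occupancy (fun i _ => hs.measurable_greedy hq i) hh
  integral_mem_Icc (hs.measurable_bellmanError (Or.inl hq) hq hh).aemeasurable
    (hs.bellmanError_mem_Icc (Or.inl hq) hq hh)

theorem sq_meanBellmanError_le {p : QTuple S A} (hp : p ∈ tuples M.H F) (hq : q ∈ tuples M.H F)
    (hh : h < M.H) :
    (∫ x, bellmanError M q q h x ∂occupancy M (greedy p) h) ^ 2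
      ≤ meanSqError M greedy q q h p := by
  have hm := hs.measurable_bellmanError (Or.inl hq) hq hh
  have := isProbabilityMeasure_occupancy (fun i _ => hs.measurable_greedy hp i) hh
  refine (sq_integral_le (MemLp.of_bound hm.aestronglyMeasurable 1 (ae_of_all _ fun x =>
    abs_le.mpr (hs.bellmanError_mem_Icc (Or.inl hq) hq hh x)))).trans_eq ?_
  exact integral_occupancy (hs.measurable_greedy hp h) (hm.pow_const 2)

theorem measurable_bellmanError_greedy {P : Type*} [MeasurableSpace P] {q : P → QTuple S A}
    (hq : ∀ p, q p ∈ tuples M.H F)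
    (hfun : ∀ h < M.H, Measurable fun x : P × (S × A) => q x.1 h x.2)
    (hpolicy : ∀ h < M.H, Measurable fun x : P × S => greedy (q x.1) h x.2) (hh : h < M.H) :
    Measurable fun x : P × S => bellmanError M (q x.1) (q x.1) h (x.2, greedy (q x.1) h x.2) := by
  have hgreedy : ∀ h < M.H, Measurable fun x : P × S => q x.1 h (x.2, greedy (q x.1) h x.2) :=
    fun h hh => (hfun h hh).comp (measurable_fst.prodMk (measurable_snd.prodMk (hpolicy h hh)))
  have hpair : Measurable fun x : P × S => (x.2, greedy (q x.1) h x.2) :=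
    measurable_snd.prodMk (hpolicy h hh)
  have hsup : Measurable fun x : P × S => ⨆ a, q x.1 (h + 1) (x.2, a) := by
    simp_rw [fun x : P × S => hs.iSup_eq_greedy (hq x.1) (h + 1) x.2]
    rcases lt_or_ge (h + 1) M.H with hh' | hh'
    · exact hgreedy _ hh'
    · simp_rw [fun p => eq_zero_of_mem_tuples (hq p) hh']
      exact measurable_const
  have hnext : Measurable fun x : P × S =>
      ∫ y, ⨆ a, q x.1 (h + 1) (y, a) ∂M.P h (x.2, greedy (q x.1) h x.2) :=
    ((hsup.comp ((measurable_fst.comp measurable_fst).prodMk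
      measurable_snd)).stronglyMeasurable.integral_kernel_prod_right'
        (κ := (M.P h).comap _ hpair)).measurable
  exact (hgreedy h hh).sub (((M.measurable_r h).comp hpair).add hnext)

end Setting

namespace IsRun

variable [mΩ : MeasurableSpace Ω] {Pr : Measure Ω} {𝓖 : ℕ → ℕ → MeasurableSpace Ω}
  (run : IsRun Pr M F G greedy K β 𝓖 s f) (hs : Setting M F G greedy)
include run

section

variable (hc : Concentrated M F G greedy K s f β ω)
include hs hc

theorem regret_le_sum_meanBellmanError (hk : k < K) :
    regret M greedy (f k ω) ≤ ∑ h ∈ Finset.range M.H, meanBellmanError M greedy h (f k ω) :=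
  (sub_le_sub_right (run.vStar_le_of_concentrated hs hc hk) _).trans_eq
    (hs.iSup_sub_value_eq_sum_bellmanError (run.mem k hk ω))

variable (hβ : 0 ≤ β) (hη : 0 < η) (hh : h < M.H)
include hβ hη hh

theorem sum_meanBellmanError_le (hd : dimDE (residuals M F h) (greedyFamily M F greedy h) η ≤ d) :
    ∑ k ∈ Finset.range K, meanBellmanError M greedy h (f k ω)
      ≤ K * η + d + 2 * √(d * (10 * β) * K) := by
  refine (Finset.sum_le_sum fun _ _ => le_abs_self _).trans (sum_abs_integral_le_of_dimDE_le hη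
    (by positivity) hd (fun k hk => ⟨f k ω, run.mem k hk ω, rfl⟩)
    (fun k hk => ⟨f k ω, run.mem k hk ω, rfl⟩)
    (fun k hk => abs_le.mpr (hs.meanBellmanError_mem_Icc (run.mem k hk ω) hh)) fun k hk => ?_)
  refine (Finset.sum_le_sum fun t ht => ?_).trans (run.sum_meanSqError_le hs hc hk hh)
  have ht : t < K := (Finset.mem_range.mp ht).trans hk
  exact hs.sq_meanBellmanError_le (run.mem t ht ω) (run.mem k hk ω) hh

theorem sum_bellmanError_visit_le (hd : dimDE (residuals M F h) (diracFamily S A h) η ≤ d) :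
    ∑ k ∈ Finset.range K, bellmanError M (f k ω) (f k ω) h (visit greedy s f k h ω)
      ≤ K * η + d + 2 * √(d * (10 * β) * K) := by
  have hdirac : ∀ k < K, ∀ x, ∫ y, bellmanError M (f k ω) (f k ω) h y ∂Measure.dirac x
      = bellmanError M (f k ω) (f k ω) h x := fun k hk x =>
    integral_dirac' _ x (hs.measurable_bellmanError (Or.inl (run.mem k hk ω))
      (run.mem k hk ω) hh).stronglyMeasurable
  refine (Finset.sum_le_sum fun k hk => ?_).trans (sum_abs_integral_le_of_dimDE_le
    (φ := fun k => bellmanError M (f k ω) (f k ω) h)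
    (μ := fun k => Measure.dirac (visit greedy s f k h ω)) hη (b := 10 * β)
    (by positivity) hd (fun k hk => ⟨f k ω, run.mem k hk ω, rfl⟩) (fun k _ => ⟨_, rfl⟩)
    (fun k hk => ?_) fun k hk => ?_)
  · rw [hdirac k (Finset.mem_range.mp hk)]
    exact le_abs_self _
  · rw [hdirac k hk]
    exact abs_le.mpr
      (hs.bellmanError_mem_Icc (Or.inl (run.mem k hk ω)) (run.mem k hk ω) hh _)
  · simp_rw [hdirac k hk]
    exact run.sum_bellmanError_visit_sq_le hs hc hk hh

end

section Measurability

variable (hk : k < K)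
include hk

theorem measurable_policy_of_lt :
    ∀ i < M.H, Measurable fun p : Ω × S => greedy (f k p.1) i p.2 := fun i hi =>
  (run.measurable_policy k hk i hi).mono
    (sup_le_sup (MeasurableSpace.comap_mono (run.le k 0)) le_rfl) le_rfl

theorem measurable_regret : Measurable fun ω => regret M greedy (f k ω) :=
  measurable_const.sub (measurable_value (π := fun ω => greedy (f k ω))
    (run.measurable_policy_of_lt hk) measurable_const)

variable (hh : h < M.H)
include hs hh

theorem measurable_bellmanError_self_greedy :
    Measurable[(𝓖 k 0).prod inferInstance] fun p : Ω × S =>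
      bellmanError M (f k p.1) (f k p.1) h (p.2, greedy (f k p.1) h p.2) :=
  @Setting.measurable_bellmanError_greedy S A _ _ M F G greedy h hs Ω (𝓖 k 0) (f k) (run.mem k hk)
    (run.measurable_fun k hk) (run.measurable_policy k hk) hh

theorem measurable_bellmanError_self_visit :
    Measurable fun ω => bellmanError M (f k ω) (f k ω) h (visit greedy s f k h ω) :=
  ((run.measurable_bellmanError_self_greedy hs hk hh).mono
    (sup_le_sup (MeasurableSpace.comap_mono (run.le k 0)) le_rfl) le_rfl).comp
    (measurable_id.prodMk ((run.measurable_state k hk h hh.le).mono (run.le k h) le_rfl))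

theorem measurable_meanBellmanError : Measurable fun ω => meanBellmanError M greedy h (f k ω) := by
  simp_rw [fun ω => hs.meanBellmanError_eq_integral_stateLaw (run.mem k hk ω) hh]
  exact measurable_integral_stateLaw (π := fun ω => greedy (f k ω))
    (g := fun p => bellmanError M (f k p.1) (f k p.1) h (p.2, greedy (f k p.1) h p.2))
    (run.measurable_policy_of_lt hk) measurable_const (by omega)
    ((run.measurable_bellmanError_self_greedy hs hk hh).mono
      (sup_le_sup (MeasurableSpace.comap_mono (run.le k 0)) le_rfl) le_rfl)

end Measurability

section Expectation

variable [IsFiniteMeasure Pr]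
include hs

theorem integrable_regret (hk : k < K) : Integrable (fun ω => regret M greedy (f k ω)) Pr :=
  Integrable.of_mem_Icc 0 1 (run.measurable_regret hk).aemeasurable
    (ae_of_all _ fun ω => hs.regret_mem_Icc (run.mem k hk ω))

variable (hk : k < K) (hh : h < M.H)
include hk hh

theorem integrable_bellmanError_visit :
    Integrable (fun ω => bellmanError M (f k ω) (f k ω) h (visit greedy s f k h ω)) Pr :=
  Integrable.of_mem_Icc (-1) 1 (run.measurable_bellmanError_self_visit hs hk hh).aemeasurable
    (ae_of_all _ fun ω =>
      hs.bellmanError_mem_Icc (Or.inl (run.mem k hk ω)) (run.mem k hk ω) hh _)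

theorem integrable_meanBellmanError :
    Integrable (fun ω => meanBellmanError M greedy h (f k ω)) Pr :=
  Integrable.of_mem_Icc (-1) 1 (run.measurable_meanBellmanError hs hk hh).aemeasurable
    (ae_of_all _ fun ω => hs.meanBellmanError_mem_Icc (run.mem k hk ω) hh)

theorem integral_meanBellmanError :
    ∫ ω, meanBellmanError M greedy h (f k ω) ∂Pr
      = ∫ ω, bellmanError M (f k ω) (f k ω) h (visit greedy s f k h ω) ∂Pr := by
  simp_rw [fun ω => hs.meanBellmanError_eq_integral_stateLaw (run.mem k hk ω) hh]
  exact (run.integral_state hk hh.le (run.measurable_bellmanError_self_greedy hs hk hh) fun p =>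
    hs.bellmanError_mem_Icc (Or.inl (run.mem k hk p.1)) (run.mem k hk p.1) hh _).symm

end Expectation

variable [IsProbabilityMeasure Pr]
include hs

theorem integral_regret_le (hk : k < K) :
    ∫ ω, regret M greedy (f k ω) ∂Pr
      ≤ ∑ h ∈ Finset.range M.H, ∫ ω, meanBellmanError M greedy h (f k ω) ∂Pr
        + (1 + M.H) * Pr.real {ω | ¬Concentrated M F G greedy K s f β ω} := by
  have hint : ∀ h ∈ Finset.range M.H,
      Integrable (fun ω => meanBellmanError M greedy h (f k ω)) Pr := fun h hh =>
    run.integrable_meanBellmanError hs hk (Finset.mem_range.mp hh)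
  have hdiff := integral_le_add_mul_measureReal (a := 0) (c := 1 + M.H)
    (B := {ω | ¬Concentrated M F G greedy K s f β ω})
    ((run.integrable_regret hs hk).sub (integrable_finsetSum _ hint))
    (fun ω hω => sub_nonpos.mpr (run.regret_le_sum_meanBellmanError hs (not_not.mp hω) hk))
    fun ω => ?_
  · rw [integral_sub' (run.integrable_regret hs hk) (integrable_finsetSum _ hint),
      integral_finsetSum _ hint] at hdiff
    linarith
  · have hregret := (hs.regret_mem_Icc (run.mem k hk ω)).2
    have hmean := Finset.card_nsmul_le_sum (Finset.range M.H)
      (fun h => meanBellmanError M greedy h (f k ω)) (-1) fun h hh =>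
        (hs.meanBellmanError_mem_Icc (run.mem k hk ω) (Finset.mem_range.mp hh)).1
    simp only [Finset.card_range, nsmul_eq_mul] at hmean
    simp only [Pi.sub_apply]
    linarith

variable (hβ : 0 ≤ β) (hη : 0 < η)
include hβ hη

theorem sum_integral_meanBellmanError_le (hh : h < M.H)
    (hd : dimDE (residuals M F h) (diracFamily S A h) η ≤ d ∨
      dimDE (residuals M F h) (greedyFamily M F greedy h) η ≤ d) :
    ∑ k ∈ Finset.range K, ∫ ω, meanBellmanError M greedy h (f k ω) ∂Pr
      ≤ K * η + d + 2 * √(d * (10 * β) * K)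
        + K * Pr.real {ω | ¬Concentrated M F G greedy K s f β ω} := by
  have hK : ∀ {X : ℕ → ℝ}, (∀ k < K, X k ≤ 1) → ∑ k ∈ Finset.range K, X k
      ≤ K * η + d + 2 * √(d * (10 * β) * K) + K := fun hX => by
    have hsum := Finset.sum_le_card_nsmul (Finset.range K) _ 1 fun k hk =>
      hX k (Finset.mem_range.mp hk)
    simp only [Finset.card_range, nsmul_eq_mul, mul_one] at hsum
    exact hsum.trans (le_add_of_nonneg_left (by positivity))
  rcases hd with hd | hd
  · have hint : ∀ k ∈ Finset.range K, Integrable (fun ω =>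
        bellmanError M (f k ω) (f k ω) h (visit greedy s f k h ω)) Pr := fun k hk =>
      run.integrable_bellmanError_visit hs (Finset.mem_range.mp hk) hh
    rw [Finset.sum_congr rfl fun k hk =>
      run.integral_meanBellmanError hs (Finset.mem_range.mp hk) hh, ← integral_finsetSum _ hint]
    exact integral_le_add_mul_measureReal (integrable_finsetSum _ hint)
      (fun ω hω => run.sum_bellmanError_visit_le hs (not_not.mp hω) hβ hη hh hd) fun ω =>
        hK fun k hk => (hs.bellmanError_mem_Icc (Or.inl (run.mem k hk ω)) (run.mem k hk ω) hh _).2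
  · have hint : ∀ k ∈ Finset.range K,
        Integrable (fun ω => meanBellmanError M greedy h (f k ω)) Pr := fun k hk =>
      run.integrable_meanBellmanError hs (Finset.mem_range.mp hk) hh
    rw [← integral_finsetSum _ hint]
    exact integral_le_add_mul_measureReal (integrable_finsetSum _ hint)
      (fun ω hω => run.sum_meanBellmanError_le hs (not_not.mp hω) hβ hη hh hd) fun ω =>
        hK fun k hk => (hs.meanBellmanError_mem_Icc (run.mem k hk ω) hh).2

theorem sum_integral_regret_le_add_measureReal
    (hd : dimBE M F (diracFamily S A) η ≤ d ∨ dimBE M F (greedyFamily M F greedy) η ≤ d) :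
    ∑ k ∈ Finset.range K, ∫ ω, regret M greedy (f k ω) ∂Pr
      ≤ M.H * (K * η + d + 2 * √(d * (10 * β) * K))
        + (1 + 2 * M.H) * (K * Pr.real {ω | ¬Concentrated M F G greedy K s f β ω}) := by
  have hmean : ∀ h ∈ Finset.range M.H, _ := fun h hh =>
    run.sum_integral_meanBellmanError_le (d := d) hs hβ hη (Finset.mem_range.mp hh)
      (hd.imp (dimDE_le_dimBE (Finset.mem_range.mp hh)).trans
        (dimDE_le_dimBE (Finset.mem_range.mp hh)).trans)
  have hregret : ∀ k ∈ Finset.range K, _ := fun k hk =>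
    run.integral_regret_le hs (Finset.mem_range.mp hk)
  refine (Finset.sum_le_sum hregret).trans ?_
  rw [Finset.sum_add_distrib, Finset.sum_comm]
  refine (add_le_add_left (Finset.sum_le_sum hmean) _).trans_eq ?_
  simp only [Finset.sum_const, Finset.card_range, nsmul_eq_mul]
  ring

end IsRun

end Regret

section UniformChoice

variable {Ω ι : Type*} [MeasurableSpace Ω] {Pr : Measure Ω} [IsProbabilityMeasure Pr] [Fintype ι]
  [MeasurableSpace ι] [MeasurableSingletonClass ι]

theorem integral_uniformOn_univ (g : ι → ℝ) :
    ∫ i, g i ∂uniformOn (Set.univ : Set ι) = (Fintype.card ι : ℝ)⁻¹ * ∑ i, g i := by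
  rw [uniformOn, ProbabilityTheory.cond, Measure.restrict_univ, integral_smul_measure,
    integral_count, Measure.count_univ]
  simp

theorem half_le_prod_uniformOn [Nonempty ι] {X : ι → Ω → ℝ} {η : ℝ} (hη : 0 < η)
    (hmeas : ∀ i, Measurable (X i)) (hint : ∀ i, Integrable (X i) Pr)
    (hnonneg : ∀ i ω, 0 ≤ X i ω)
    (hle : ∑ i, ∫ ω, X i ω ∂Pr ≤ Fintype.card ι * (η / 2)) :
    1 / 2 ≤ (Pr.prod (uniformOn (Set.univ : Set ι))) {p | X p.2 p.1 ≤ η} := by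
  have : IsProbabilityMeasure (uniformOn (Set.univ : Set ι)) :=
    isProbabilityMeasure_uniformOn Set.finite_univ Set.univ_nonempty
  set μ := Pr.prod (uniformOn (Set.univ : Set ι))
  have hintegrable : Integrable (fun p : Ω × ι => X p.2 p.1) μ :=
    (integrable_prod_iff' (measurable_from_prod_countable_left hmeas).aestronglyMeasurable).mpr
      ⟨ae_of_all _ hint, .of_finite⟩
  have hmean : ∫ p, X p.2 p.1 ∂μ ≤ η / 2 := by
    rw [integral_prod_symm _ hintegrable, integral_uniformOn_univ, inv_mul_le_iff₀ (by positivity)]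
    exact hle
  have hmarkov : η * μ.real {p | η ≤ X p.2 p.1} ≤ η / 2 :=
    (mul_meas_ge_le_integral_of_nonneg (ae_of_all _ fun p : Ω × ι => hnonneg p.2 p.1)
      hintegrable η).trans hmean
  have hcover : (1 : ℝ) ≤ μ.real {p | X p.2 p.1 ≤ η} + μ.real {p | η ≤ X p.2 p.1} := by
    rw [← probReal_univ (μ := μ)]
    exact (measureReal_mono fun p _ => le_total (X p.2 p.1) η).trans (measureReal_union_le _ _)
  have hhalf : (1 / 2 : ℝ) ≤ μ.real {p | X p.2 p.1 ≤ η} := by nlinarith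
  simpa using (ENNReal.ofReal_le_iff_le_toReal (measure_ne_top μ _)).mpr hhalf

end UniformChoice

section Numerics

variable {H d N K ε : ℝ} (hH : 1 ≤ H) (hd : 1 ≤ d) (hN : 1 ≤ N) (hε : 0 < ε) (hε' : ε ≤ 1 / 2)
include hH hd hN hε hε'

theorem half_le_log_mul_div : 1 / 2 ≤ Real.log (N * (H * d / ε)) := by
  have hHd : 1 ≤ H * d := one_le_mul_of_one_le_of_one_le hH hd
  have htwo : 2 ≤ H * d / ε := by
    rw [le_div_iff₀ hε]
    linarith
  have hlog := Real.log_le_log two_pos (htwo.trans (le_mul_of_one_le_left (by positivity) hN))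
  linarith [Real.log_two_gt_d9]

variable (hL : H ^ 2 * d / ε ^ 2 * Real.log (N * (H * d / ε)) ≤ K)
include hL

theorem mul_le_mul_of_mul_log_le : H * d ≤ K * ε := by
  have hhalf : H ^ 2 * d / ε ^ 2 * (1 / 2) ≤ K :=
    (mul_le_mul_of_nonneg_left (half_le_log_mul_div hH hd hN hε hε') (by positivity)).trans hL
  have hK : 0 ≤ K := le_trans (by positivity) hhalf
  rw [div_mul_eq_mul_div, div_le_iff₀ (by positivity)] at hhalf
  calc H * d ≤ H ^ 2 * d := by
        gcongr
        exact le_self_pow₀ hH two_ne_zero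
    _ ≤ K * ε * (2 * ε) := by linarith
    _ ≤ K * ε := mul_le_of_le_one_right (by positivity) (by linarith)

theorem log_mul_div_le_log_mul_mul : Real.log (N * (H * d / ε)) ≤ Real.log (N * (H * K)) := by
  have hK : H * d / ε ≤ K := (div_le_iff₀ hε).mpr (mul_le_mul_of_mul_log_le hH hd hN hε hε' hL)
  have hK0 : 0 ≤ K := le_trans (by positivity) hK
  refine Real.log_le_log (by positivity) ?_
  gcongr
  exact hK.trans (le_mul_of_one_le_left hK0 hH)

theorem log_mul_mul_le : Real.log (N * (H * K)) ≤ 4 * (K * (ε ^ 2 / (H ^ 2 * d))) := by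
  set q := H ^ 2 * d / ε ^ 2
  have hq : 0 < q := by positivity
  have hK : 0 < K :=
    lt_of_lt_of_le (mul_pos hq (by linarith [half_le_log_mul_div hH hd hN hε hε'])) hL
  have hcube : N * H * q ≤ (N * (H * d / ε)) ^ 3 := by
    have hone : 1 ≤ N ^ 2 * d ^ 2 / ε := by
      rw [one_le_div hε]
      linarith [one_le_mul_of_one_le_of_one_le (one_le_pow₀ hN (n := 2)) (one_le_pow₀ hd (n := 2))]
    calc N * H * q ≤ N * H * q * (N ^ 2 * d ^ 2 / ε) := le_mul_of_one_le_right (by positivity) hone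
      _ = (N * (H * d / ε)) ^ 3 := by
        simp only [q]
        field_simp
  have hlog : Real.log (N * (H * d / ε)) ≤ K / q := (le_div_iff₀' hq).mpr hL
  calc Real.log (N * (H * K)) = Real.log (N * H * q) + Real.log (K / q) := by
        rw [← Real.log_mul (by positivity) (by positivity)]
        congr 1
        field_simp
    _ ≤ Real.log ((N * (H * d / ε)) ^ 3) + K / q :=
        add_le_add (Real.log_le_log (by positivity) hcube) (Real.log_le_self (by positivity))
    _ ≤ 4 * (K / q) := by
        rw [Real.log_pow]
        push_cast
        linarith
    _ = 4 * (K * (ε ^ 2 / (H ^ 2 * d))) := by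
        simp only [q]
        field_simp

end Numerics

theorem regretBound_le {H d K ε c β : ℝ} (hH : 1 ≤ H) (hd : 1 ≤ d) (hε : 0 < ε) (hc : 1 ≤ c)
    (hHd : H * d ≤ K * ε) (hβ : β ≤ 5 * c * (K * (ε ^ 2 / (H ^ 2 * d)))) :
    H * (K * (ε / H) + d + 2 * √(d * (10 * β) * K)) + 6 * H ≤ (8 + 16 * c) * (K * ε) := by
  have hK : 0 ≤ K := nonneg_of_mul_nonneg_left (le_trans (by positivity) hHd) hε
  have hsqrt : √(d * (10 * β) * K) ≤ 8 * c * (K * ε / H) := by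
    refine Real.sqrt_le_iff.mpr ⟨by positivity, ?_⟩
    calc d * (10 * β) * K ≤ d * (10 * (5 * c * (K * (ε ^ 2 / (H ^ 2 * d))))) * K := by gcongr
      _ = 50 * c * (K * ε / H) ^ 2 := by
          field_simp
          ring
      _ ≤ (8 * c) ^ 2 * (K * ε / H) ^ 2 := by
          gcongr
          nlinarith
      _ = (8 * c * (K * ε / H)) ^ 2 := by ring
  have hH6 : 6 * H ≤ 6 * (K * ε) := by nlinarith
  calc H * (K * (ε / H) + d + 2 * √(d * (10 * β) * K)) + 6 * H
      ≤ H * (K * (ε / H) + d + 2 * (8 * c * (K * ε / H))) + 6 * H := by gcongr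
    _ = K * ε + H * d + 16 * c * (K * ε) + 6 * H := by
        field_simp
        ring
    _ ≤ (8 + 16 * c) * (K * ε) := by linarith

theorem confidenceLevel_mem_Icc {m ℓ logK Kρ β : ℝ} (hm : 1 ≤ m) (hlog : ℓ ≤ logK)
    (hlogK : 0 ≤ logK) (hKρ : 0 ≤ Kρ)
    (hβ : β = 28 * (1 + m) * (logK + Kρ) ∨ Kρ ≤ m * ℓ ∧ β = 28 * (1 + m) * logK) :
    β ∈ Set.Icc (28 * (logK + Kρ)) (28 * (1 + m) * (logK + Kρ)) := by
  rcases hβ with rfl | ⟨hm', rfl⟩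
  · exact ⟨by nlinarith, le_rfl⟩
  · exact ⟨by nlinarith, by nlinarith⟩

section Main

variable {Ω S A : Type*} [MeasurableSpace S] [MeasurableSpace A] {M : MDP S A}
  {F G : ℕ → Set (S × A → ℝ)} {greedy : QTuple S A → ℕ → S → A} {K N d : ℕ} {β ρ ε η : ℝ}
  {s : ℕ → ℕ → Ω → S} {f : ℕ → Ω → QTuple S A}

theorem Setting.one_le_of_coverNum_le (hs : Setting M F G greedy)
    (hN : coverNum (tuples M.H F ∪ tuples M.H G) ρ ≤ N) : 1 ≤ N := by
  obtain ⟨C, hcard, hcover⟩ := exists_cover_of_coverNum_le hN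
  obtain ⟨g, hg, -⟩ := hcover _ (Or.inl hs.qStarTuple_mem)
  exact_mod_cast (Set.one_le_encard_iff_nonempty.mpr ⟨g, hg⟩).trans hcard

namespace IsRun

variable [MeasurableSpace Ω] {Pr : Measure Ω} [IsProbabilityMeasure Pr]
  {𝓖 : ℕ → ℕ → MeasurableSpace Ω} (run : IsRun Pr M F G greedy K β 𝓖 s f)
  (hs : Setting M F G greedy)
include run hs

section

variable (hH : 1 ≤ M.H) (hρ : 0 ≤ ρ) (hN : coverNum (tuples M.H F ∪ tuples M.H G) ρ ≤ N)
  (hβ : 2 * Real.log (N * (M.H * K)) + 28 * K * ρ ≤ β)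
include hH hρ hN hβ

theorem mul_measureReal_not_concentrated_le :
    K * Pr.real {ω | ¬Concentrated M F G greedy K s f β ω} ≤ 2 := by
  rcases K.eq_zero_or_pos with rfl | hK
  · simp
  set x : ℝ := N * (M.H * K) with hx
  have hKx : (K : ℝ) ≤ x := by
    have hHN : 1 ≤ N * M.H := one_le_mul (hs.one_le_of_coverNum_le hN) hH
    rw [hx, ← mul_assoc]
    exact_mod_cast Nat.le_mul_of_pos_left K hHN
  have hx0 : 0 < x := lt_of_lt_of_le (by exact_mod_cast hK) hKx
  have hexp : Real.exp (-(β - 28 * K * ρ)) ≤ (x ^ 2)⁻¹ := by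
    rw [Real.exp_neg, ← Real.exp_log (pow_pos hx0 2), Real.log_pow]
    gcongr
    push_cast
    linarith
  have hprob := run.measureReal_not_concentrated_le hs hρ hN (β - 28 * K * ρ)
  rw [sub_add_cancel] at hprob
  calc K * Pr.real {ω | ¬Concentrated M F G greedy K s f β ω} ≤ x * (2 * x * (x ^ 2)⁻¹) := by
        gcongr
        exact hprob.trans (by gcongr)
    _ = 2 := by field_simp

theorem sum_integral_regret_le (hη : 0 < η)
    (hd : dimBE M F (diracFamily S A) η ≤ d ∨ dimBE M F (greedyFamily M F greedy) η ≤ d) :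
    ∑ k ∈ Finset.range K, ∫ ω, regret M greedy (f k ω) ∂Pr
      ≤ M.H * (K * η + d + 2 * √(d * (10 * β) * K)) + 6 * M.H := by
  have hlog : 0 ≤ Real.log (N * (M.H * K)) := by exact_mod_cast Real.log_natCast_nonneg _
  have hβ0 : 0 ≤ β := le_trans (by positivity) hβ
  refine (run.sum_integral_regret_le_add_measureReal hs hβ0 hη hd).trans
    (add_le_add_right ?_ _)
  have hH' : (1 : ℝ) ≤ M.H := by exact_mod_cast hH
  calc _ ≤ (1 + 2 * (M.H : ℝ)) * 2 := by
        gcongr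
        exact run.mul_measureReal_not_concentrated_le hs hH hρ hN hβ
    _ ≤ 6 * M.H := by linarith

end

variable (hK : 1 ≤ K)
include hK

theorem probOptimal_eq_one (hη : 1 ≤ η) : probOptimal Pr M greedy K f η = 1 := by
  have : Nonempty (Fin K) := ⟨⟨0, hK⟩⟩
  have : IsProbabilityMeasure (uniformOn (Set.univ : Set (Fin K))) :=
    isProbabilityMeasure_uniformOn Set.finite_univ Set.univ_nonempty
  have huniv : {p : Ω × Fin K | vStar M 0 M.s₁ - η ≤ value M (greedy (f p.2 p.1)) 0 M.s₁}
      = Set.univ := by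
    refine Set.eq_univ_of_forall fun p => sub_le_comm.mp (le_trans ?_ hη)
    exact (hs.regret_mem_Icc (run.mem p.2 p.2.2 p.1)).2
  rw [probOptimal, huniv, measure_univ]

theorem half_le_probOptimal_of_sum_integral_regret_le (hη : 0 < η)
    (hle : ∑ k ∈ Finset.range K, ∫ ω, regret M greedy (f k ω) ∂Pr ≤ K * (η / 2)) :
    1 / 2 ≤ probOptimal Pr M greedy K f η := by
  have : Nonempty (Fin K) := ⟨⟨0, hK⟩⟩
  refine (half_le_prod_uniformOn (Pr := Pr) (X := fun (k : Fin K) ω => regret M greedy (f k ω)) hη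
    (fun k => run.measurable_regret k.2) (fun k => run.integrable_regret hs k.2)
    (fun k ω => (hs.regret_mem_Icc (run.mem k k.2 ω)).1)
    ?_).trans_eq ?_
  · rwa [Fin.sum_univ_eq_sum_range fun k => ∫ ω, regret M greedy (f k ω) ∂Pr, Fintype.card_fin]
  · simp only [probOptimal, regret, sub_le_comm]

theorem half_le_probOptimal (hH : 1 ≤ M.H) {m : ℝ} (hm : 1 ≤ m) (hε : 0 < ε) (hε' : ε ≤ 1 / 2)
    (hd1 : 1 ≤ d)
    (hd : dimBE M F (diracFamily S A) (ε / M.H) ≤ d ∨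
      dimBE M F (greedyFamily M F greedy) (ε / M.H) ≤ d)
    (hρ : ρ = ε ^ 2 / (M.H ^ 2 * d)) (hN : coverNum (tuples M.H F ∪ tuples M.H G) ρ ≤ N)
    (hL : M.H ^ 2 * d / ε ^ 2 * Real.log (N * (M.H * d / ε)) ≤ K)
    (hβ : β = 28 * (1 + m) * (Real.log (N * (M.H * K)) + K * ρ) ∨
      K ≤ m * (M.H ^ 2 * d / ε ^ 2 * Real.log (N * (M.H * d / ε))) ∧
        β = 28 * (1 + m) * Real.log (N * (M.H * K))) :
    1 / 2 ≤ probOptimal Pr M greedy K f ((16 + 32 * (28 * (1 + m))) * ε) := by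
  have hHr : (1 : ℝ) ≤ M.H := by exact_mod_cast hH
  have hdr : (1 : ℝ) ≤ d := by exact_mod_cast hd1
  have hNr : (1 : ℝ) ≤ N := by exact_mod_cast hs.one_le_of_coverNum_le hN
  have hρ0 : 0 ≤ ρ := by rw [hρ]; positivity
  have hlog0 : 0 ≤ Real.log (N * (M.H * K)) := by exact_mod_cast Real.log_natCast_nonneg _
  have hlog := log_mul_mul_le hHr hdr hNr hε hε' hL
  rw [← hρ] at hlog
  have hKρ : ∀ ℓ, K ≤ m * (M.H ^ 2 * d / ε ^ 2 * ℓ) → K * ρ ≤ m * ℓ := fun ℓ hℓ =>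
    (mul_le_mul_of_nonneg_right hℓ hρ0).trans_eq (by rw [hρ]; field_simp)
  obtain ⟨hβ₁, hβ₂⟩ := confidenceLevel_mem_Icc hm
    (log_mul_div_le_log_mul_mul hHr hdr hNr hε hε' hL) hlog0 (by positivity : 0 ≤ K * ρ)
    (hβ.imp_right (And.imp_left (hKρ _)))
  refine run.half_le_probOptimal_of_sum_integral_regret_le hs hK (by positivity) ?_
  refine (run.sum_integral_regret_le hs hH hρ0 hN (by linarith) (by positivity) hd).trans ?_
  refine (regretBound_le (c := 28 * (1 + m)) hHr hdr hε (by linarith)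
    (mul_le_mul_of_mul_log_le hHr hdr hNr hε hε' hL) ?_).trans_eq (by ring)
  rw [← hρ]
  nlinarith

end IsRun

end Main

end Golf

end

theorem corollary2 :
    ∀ m : ℝ, 1 ≤ m → ∃ c : ℝ, 0 < c ∧ ∃ C : ℝ, 0 < C ∧
      ∀ (S A Ω : Type*) [MeasurableSpace S] [MeasurableSpace A] [MeasurableSpace Ω]
        (Pr : MeasureTheory.Measure Ω) [MeasureTheory.IsProbabilityMeasure Pr]
        (M : Golf.MDP S A) (F G : ℕ → Set (S × A → ℝ))
        (greedy : Golf.QTuple S A → ℕ → S → A),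
        0 < M.H →
        Golf.IsFunctionClass M.H F → Golf.IsFunctionClass M.H G →
        Golf.IsGreedyRule M.H F greedy →
        Golf.Realizable M F → Golf.Complete M F G →
      ∀ (ε : ℝ), 0 < ε → ε ≤ 1 →
      ∀ (d N K : ℕ) (ρ L β : ℝ),
        (d : ℕ∞) = max 1
          (min (Golf.dimBE M F (Golf.diracFamily S A) (ε / M.H))
            (Golf.dimBE M F (Golf.greedyFamily M F greedy) (ε / M.H))) →
        ρ = ε ^ 2 / (M.H ^ 2 * d) →
        (N : ℕ∞) = Golf.coverNum (Golf.tuples M.H F ∪ Golf.tuples M.H G) ρ →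
        L = M.H ^ 2 * d / ε ^ 2 * Real.log (N * (M.H * d / ε)) →
        1 ≤ K → L ≤ K →
        (β = c * (Real.log (N * (M.H * K)) + K * ρ) ∨
          (K ≤ m * L ∧ β = c * Real.log (N * (M.H * K)))) →
      ∀ (𝓖 : ℕ → ℕ → MeasurableSpace Ω) (s : ℕ → ℕ → Ω → S) (f : ℕ → Ω → Golf.QTuple S A),
        Golf.IsRun Pr M F G greedy K β 𝓖 s f →
        1 / 2 ≤ Golf.probOptimal Pr M greedy K f (C * ε) := by
  intro m hm
  refine ⟨28 * (1 + m), by positivity, 16 + 32 * (28 * (1 + m)), by positivity, ?_⟩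
  intro S A Ω _ _ _ Pr _ M F G greedy hH hF hG hgreedy hreal hcomp ε hε _ d N K ρ L β hd hρ hN hL
    hK hLK hβ 𝓖 s f run
  have hs : Golf.Setting M F G greedy := ⟨hF, hG, hgreedy, hreal, hcomp⟩
  rcases le_or_gt ε (1 / 2) with hε' | hε'
  · subst hL
    have hd1 : 1 ≤ d := by exact_mod_cast (le_max_left _ _).trans_eq hd.symm
    exact run.half_le_probOptimal hs hK hH hm hε hε' hd1
      (min_le_iff.mp ((le_max_right _ _).trans_eq hd.symm)) hρ hN.ge hLK hβ
  · rw [run.probOptimal_eq_one hs hK (by nlinarith)]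
    exact ENNReal.half_le_self
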